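/- Let $a>1$, let $k_\nu(x)=\frac{2}{\pi}\int_0^{\pi/2}\cos(x\tan u-\nu u)\,du$ be the Bateman function, and put $\psi(u)=i(\tan u-au)$, $u_0=\arctan\sqrt{a-1}$ (so that $\pm u_0$ are the saddle points of $\psi$ in $(-\frac{\pi}{2},\frac{\pi}{2})$). There is a unique sequence of real numbers $A_{2k}=A_{2k}(a)$, $k\ge 0$, with the following property: for the analytic function $u(w)$ near $w=0$ that satisfies $-w^2=\psi(u(w))-\psi(u_0)$, $u(0)=u_0$ and $u'(0)=\sqrt{i/a}\,(a-1)^{-1/4}$ (principal square root), the even part of the Maclaurin series of $du/dw$ is $$\sqrt{\frac{i}{a}}\,(a-1)^{-1/4}\sum_{k\ge0}i^kA_{2k}(a)\,w^{2k}.$$ Its first members are $$A_0=1,\quad A_2=\frac{8-12a+9a^2}{24a(a-1)^{3/2}},\quad A_4=\frac{64-192a+288a^2+360a^3-135a^4}{3456a^2(a-1)^3},$$ $$A_6=\frac{-71168+320256a-554688a^2+518400a^3+340200a^4-170100a^5+42525a^6}{6220800a^3(a-1)^{9/2}},$$ $$A_8=\frac{-2338816+14032896a-36790272a^2+55710720a^3-32876928a^4+231880320a^5-68584320a^6+30618000a^7-5740875a^8}{4180377600a^4(a-1)^6}.$$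 As $x\to+\infty$ with $\nu=ax$ and $a$ fixed, $k_\nu(x)$ has the asymptotic expansion $$k_{ax}(x)\sim\frac{2(a-1)^{-1/4}}{\sqrt{\pi ax}}\left\{\cos\Phi(x)\sum_{k=0}^\infty\frac{(-1)^kA_{4k}(a)\,(\frac12)_{2k}}{x^{2k}}-\frac{\sin\Phi(x)}{2x}\sum_{k=0}^\infty\frac{(-1)^kA_{4k+2}(a)\,(\frac32)_{2k}}{x^{2k}}\right\},$$ where $\Phi(x)=x\left(\sqrt{a-1}-a\arctan\sqrt{a-1}\right)+\frac{\pi}{4}$ and $(c)_n=c(c+1)\cdots(c+n-1)$. This means: for all integers $M,N\ge0$, if the first sum is truncated to its first $M$ terms and the second to its first $N$ terms, the difference of the two sides is $O\!\left(x^{-1/2}(x^{-2M}+x^{-2N-1})\right)$ as $x\to+\infty$, with an implied constant that may depend on $a$, $M$ and $N$. -/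

import Mathlib

open Filter Topology Asymptotics

noncomputable section

/-- The Bateman function `k_ν(x) = (2/π) ∫₀^{π/2} cos (x tan u - ν u) du`. -/
def batemanK (ν x : ℝ) : ℝ :=
  (2 / Real.pi) * ∫ u in (0 : ℝ)..(Real.pi / 2), Real.cos (x * Real.tan u - ν * u)

/-- The phase `ψ(u) = i (tan u - a u)` on the complex plane. -/
def psi (a : ℝ) (u : ℂ) : ℂ :=
  Complex.I * (Complex.tan u - (a : ℂ) * u)

/-- The positive real saddle point `u₀ = arctan √(a - 1)` of `ψ`, for `a > 1`. -/
def saddle (a : ℝ) : ℝ :=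
  Real.arctan (Real.sqrt (a - 1))

/-- The constant `√(i/a) (a - 1)^{-1/4}` (principal square root). -/
def inversionConst (a : ℝ) : ℂ :=
  (Complex.I / (a : ℂ)) ^ (1 / 2 : ℂ) * (((a - 1) ^ (-1 / 4 : ℝ) : ℝ) : ℂ)

/-- `u = u(w)` is the analytic local inversion at the saddle `u₀` of
`-w² = ψ(u) - ψ(u₀)`, on the branch `u(w) = u₀ + √(i/a) (a - 1)^{-1/4} w + ⋯`. -/
structure IsSaddleInversion (a : ℝ) (u : ℂ → ℂ) : Prop where
  analyticAt : AnalyticAt ℂ u 0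
  map_zero : u 0 = (saddle a : ℂ)
  deriv_zero : deriv u 0 = inversionConst a
  phase_eq : ∀ᶠ w in 𝓝 (0 : ℂ), psi a (u w) - psi a (saddle a : ℂ) = -w ^ 2

/-- `A k` is the coefficient `A_{2k}(a)`: the even part of the Maclaurin series of `du/dw` is
`√(i/a) (a - 1)^{-1/4} ∑ₖ iᵏ A_{2k}(a) w^{2k}`, where `u(w)` is the inversion at the saddle. -/
def IsSaddleCoeffs (a : ℝ) (A : ℕ → ℝ) : Prop :=
  ∃ u : ℂ → ℂ, IsSaddleInversion a u ∧
    ∀ k : ℕ, iteratedDeriv (2 * k) (deriv u) 0 / ((2 * k).factorial : ℂ) =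
      inversionConst a * (Complex.I ^ k * (A k : ℂ))

/-- The phase `Φ(x) = x (√(a - 1) - a arctan √(a - 1)) + π/4`. -/
def phasePhi (a x : ℝ) : ℝ :=
  x * (Real.sqrt (a - 1) - a * Real.arctan (Real.sqrt (a - 1))) + Real.pi / 4

/-- The Pochhammer symbol `(c)ₙ = c (c + 1) ⋯ (c + n - 1)`. -/
def poch (c : ℝ) (n : ℕ) : ℝ :=
  (ascPochhammer ℝ n).eval c

/-- The expansion with `M` terms kept in the cosine series and `N` terms in the sine series;
here `A k` stands for `A_{2k}(a)`, so that `A_{4k}` is `A (2 * k)` and `A_{4k+2}` is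
`A (2 * k + 1)`. -/
def partialExpansion (a : ℝ) (A : ℕ → ℝ) (M N : ℕ) (x : ℝ) : ℝ :=
  2 * (a - 1) ^ (-1 / 4 : ℝ) / Real.sqrt (Real.pi * a * x) *
    (Real.cos (phasePhi a x) *
        ∑ k ∈ Finset.range M, (-1) ^ k * A (2 * k) * poch (1 / 2) (2 * k) / x ^ (2 * k)
      - Real.sin (phasePhi a x) / (2 * x) *
        ∑ k ∈ Finset.range N, (-1) ^ k * A (2 * k + 1) * poch (3 / 2) (2 * k) / x ^ (2 * k))

end

/-!
The Bateman function is handled by real stationary phase, without deforming contours. By parity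
`k_{ax}(x)` is `1 / π` times the real part of `∫ exp (i x (tan u - a u)) du` over `(-π/2, π/2)`,
whose phase has the two stationary points `± u₀`.

*Localisation.* The reciprocal `cos² u / (1 - a cos² u)` of the phase derivative is smooth away
from `± u₀` and vanishes at `± π/2`. Repeated integration by parts therefore leaves no boundary
terms, in spite of the essential oscillation at the end points, and an amplitude vanishing near
`± u₀` contributes `O(x⁻ⁿ)` for every `n` (`exists_norm_integral_phase_le`). What remains are two
bumps, whose contributions are complex conjugates of each other.

*The saddle point.* Near `u₀` there is exactly one analytic coordinate `s` with
`tan u - a u = tan u₀ - a u₀ + s²` and `du/ds > 0` at `s = 0` (`saddleCoord_spec`). By uniqueness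
it commutes with conjugation, so it is real on the real axis and has real Taylor coefficients. The
inversion `u(w)` of the statement is this coordinate at `s = √i w`; hence the numbers `A_{2k}`
exist, are real and unique, and `A_{2k} / √(a √(a - 1))` is the coefficient of `s^{2k}` in `du/ds`
(`isSaddleCoeffs_saddleCoeff`, `IsSaddleCoeffs.eq_saddleCoeff`).

*The quadratic phase.* In the coordinate `s` the bump becomes `∫ exp (i x s²) G(s) ds` with `G`
smooth, compactly supported and equal to `du/ds` near `0`. Its expansion
(`exists_norm_integral_sub_sum_fresnelMoment_le`) follows from the Gaussian integral with
`z = ε - i x`, `ε → 0⁺`: an integration by parts against `exp (-z s²)` trades a factor `s²` of the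
amplitude for a factor `1 / z`, with constants uniform in the right half-plane. The `k`-th term
carries the factor `iᵏ`, so that the real part turns even `k` into the cosine series and odd `k`
into the sine series (`re_saddle_sum_eq_partialExpansion`). Expanding further than the requested
truncation orders yields the stated error.

*Explicit coefficients.* With `T = tan u` and `Q = T² - (a - 1)`, the equations `T' = a u' + 2 s`
and `T' = (1 + T²) u'` combine to `Q T' = 2 s (a + Q)`. After a rescaling that makes all
coefficients polynomials in `a`, this is a recursion which is solved to order nine
(`scaled_coeff_values`, `saddleCoeff_values`).
-/

open MeasureTheory
open scoped ContDiff

/-! ### Oscillatory Gaussian integrals -/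

theorem norm_cexp_neg_mul_sq_le_one {z : ℂ} (hz : 0 ≤ z.re) (s : ℝ) :
    ‖Complex.exp (-z * (s : ℂ) ^ 2)‖ ≤ 1 := by
  rw [norm_cexp_neg_mul_sq, Real.exp_le_one_iff]
  nlinarith [sq_nonneg s, mul_nonneg hz (sq_nonneg s)]

theorem integral_cexp_neg_mul_sq_by_parts {z : ℂ} {g g' : ℝ → ℂ}
    (hg : ∀ s, HasDerivAt g (g' s) s)
    (h1 : Integrable fun s : ℝ => Complex.exp (-z * (s : ℂ) ^ 2) * g s)
    (h2 : Integrable fun s : ℝ => Complex.exp (-z * (s : ℂ) ^ 2) * g' s)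
    (h3 : Integrable fun s : ℝ => Complex.exp (-z * (s : ℂ) ^ 2) * (s * g s)) :
    2 * z * ∫ s : ℝ, Complex.exp (-z * (s : ℂ) ^ 2) * (s * g s) =
      ∫ s : ℝ, Complex.exp (-z * (s : ℂ) ^ 2) * g' s := by
  have hd : ∀ s : ℝ, HasDerivAt (fun s : ℝ => Complex.exp (-z * (s : ℂ) ^ 2) * g s)
      (Complex.exp (-z * (s : ℂ) ^ 2) * g' s
        - 2 * z * (Complex.exp (-z * (s : ℂ) ^ 2) * (s * g s))) s := by
    intro s
    have hs : HasDerivAt (fun s : ℝ => (s : ℂ)) 1 s := Complex.ofRealCLM.hasDerivAt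
    have := (((hs.pow 2).const_mul (-z)).cexp).mul (hg s)
    refine this.congr_deriv ?_
    simp only [Nat.cast_ofNat, Pi.pow_apply]
    ring
  have := integral_eq_zero_of_hasDerivAt_of_integrable hd
    (h2.sub (h3.const_mul (2 * z))) h1
  rw [integral_sub h2 (h3.const_mul (2 * z)),
    integral_const_mul] at this
  exact (sub_eq_zero.mp this).symm

theorem contDiff_ofReal {n : WithTop ℕ∞} : ContDiff ℝ n fun s : ℝ => (s : ℂ) :=
  Complex.ofRealCLM.contDiff

theorem hasDerivAt_ofReal_pow_succ_mul {h : ℝ → ℂ} (hh : ContDiff ℝ ∞ h) (m : ℕ) (s : ℝ) :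
    HasDerivAt (fun s : ℝ => (s : ℂ) ^ (m + 1) * h s)
      ((s : ℂ) ^ m * ((m + 1 : ℂ) * h s + s * deriv h s)) s := by
  have hs : HasDerivAt (fun s : ℝ => (s : ℂ)) 1 s := Complex.ofRealCLM.hasDerivAt
  have hd : HasDerivAt h (deriv h s) s :=
    (hh.differentiable (by simp)).differentiableAt.hasDerivAt
  refine ((hs.pow (m + 1)).mul hd).congr_deriv ?_
  simp only [Pi.pow_apply, Nat.add_sub_cancel]
  push_cast
  ring

theorem contDiff_deriv_infty {h : ℝ → ℂ} (hh : ContDiff ℝ ∞ h) : ContDiff ℝ ∞ (deriv h) :=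
  (contDiff_infty_iff_deriv.mp hh).2

theorem integrable_cexp_neg_mul_sq_mul_of_hasCompactSupport (z : ℂ) {h : ℝ → ℂ}
    (hh : Continuous h) (hc : HasCompactSupport h) :
    Integrable fun s : ℝ => Complex.exp (-z * (s : ℂ) ^ 2) * h s :=
  Continuous.integrable_of_hasCompactSupport (by fun_prop) hc.mul_left

/-- A zero of order `2 n` of the amplitude at the stationary point gains a factor `z⁻ⁿ`,
uniformly in the closed right half-plane. -/
theorem exists_norm_integral_pow_mul_le (n : ℕ) :
    ∀ ρ : ℝ → ℂ, ContDiff ℝ ∞ ρ → HasCompactSupport ρ → ∃ C : ℝ, ∀ z : ℂ, z ≠ 0 → 0 ≤ z.re →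
      ‖∫ s : ℝ, Complex.exp (-z * (s : ℂ) ^ 2) * ((s : ℂ) ^ (2 * n) * ρ s)‖ ≤ C / ‖z‖ ^ n := by
  induction n with
  | zero =>
    intro ρ hρ hc
    refine ⟨∫ s, ‖ρ s‖, fun z _ hz => ?_⟩
    simp only [mul_zero, pow_zero, one_mul, div_one]
    refine norm_integral_le_of_norm_le
      (hρ.continuous.integrable_of_hasCompactSupport hc).norm (ae_of_all _ fun s => ?_)
    rw [norm_mul]
    exact mul_le_of_le_one_left (norm_nonneg _) (norm_cexp_neg_mul_sq_le_one hz s)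
  | succ n ih =>
    intro ρ hρ hc
    have hρ' := contDiff_deriv_infty hρ
    have hc' : HasCompactSupport (deriv ρ) := hc.deriv
    have hr : ContDiff ℝ ∞ fun s : ℝ => ((2 * n : ℕ) + 1 : ℂ) * ρ s + s * deriv ρ s :=
      (contDiff_const.mul hρ).add (contDiff_ofReal.mul hρ')
    have hrc : HasCompactSupport fun s : ℝ => ((2 * n : ℕ) + 1 : ℂ) * ρ s + s * deriv ρ s :=
      hc.mul_left.add hc'.mul_left
    obtain ⟨C, hC⟩ := ih _ hr hrc
    refine ⟨C / 2, fun z hz0 hz => ?_⟩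
    have key := integral_cexp_neg_mul_sq_by_parts (z := z)
      (fun s => hasDerivAt_ofReal_pow_succ_mul hρ (2 * n) s)
      (integrable_cexp_neg_mul_sq_mul_of_hasCompactSupport z
        ((Complex.continuous_ofReal.pow _).mul hρ.continuous) hc.mul_left)
      (integrable_cexp_neg_mul_sq_mul_of_hasCompactSupport z
        ((Complex.continuous_ofReal.pow _).mul hr.continuous) hrc.mul_left)
      (integrable_cexp_neg_mul_sq_mul_of_hasCompactSupport z
        (Complex.continuous_ofReal.mul ((Complex.continuous_ofReal.pow _).mul hρ.continuous))
        (hc.mul_left.mul_left))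
    have h1 := hC z hz0 hz
    rw [← key, norm_mul, norm_mul, Complex.norm_ofNat] at h1
    have hzp : 0 < ‖z‖ := norm_pos_iff.mpr hz0
    rw [le_div_iff₀ (by positivity)] at h1 ⊢
    have : ∀ s : ℝ, (s : ℂ) ^ (2 * (n + 1)) * ρ s = s * ((s : ℂ) ^ (2 * n + 1) * ρ s) := by
      intro s; ring
    simp only [this]
    rw [pow_succ]
    linarith

theorem contDiff_div_pow_of_eventually_zero {h : ℝ → ℂ} (hh : ContDiff ℝ ∞ h)
    (h0 : h =ᶠ[𝓝 0] 0) (p : ℕ) : ContDiff ℝ ∞ fun s : ℝ => h s / (s : ℂ) ^ p := by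
  rw [contDiff_iff_contDiffAt]
  intro s
  by_cases hs : s = 0
  · subst hs
    refine (contDiffAt_const (c := (0 : ℂ))).congr_of_eventuallyEq ?_
    filter_upwards [h0] with t ht
    simp [ht]
  · have h2 : ContDiffAt ℝ ∞ (fun s : ℝ => (s : ℂ) ^ p) s := (contDiff_ofReal.pow p).contDiffAt
    simp only [div_eq_mul_inv]
    exact hh.contDiffAt.mul (h2.inv (pow_ne_zero _ (by exact_mod_cast hs)))

theorem exists_norm_div_pow_le {h : ℝ → ℂ} (h0 : h =ᶠ[𝓝 0] 0) {M : ℝ} (hM : ∀ s, ‖h s‖ ≤ M)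
    (p : ℕ) : ∃ M' : ℝ, ∀ s : ℝ, ‖h s / (s : ℂ) ^ p‖ ≤ M' := by
  obtain ⟨δ, hδ, h0⟩ := Metric.eventually_nhds_iff.mp h0
  refine ⟨M / δ ^ p, fun s => ?_⟩
  have hM0 : 0 ≤ M := (norm_nonneg _).trans (hM 0)
  by_cases hs : dist s 0 < δ
  · rw [h0 hs]; simp; positivity
  · rw [norm_div, norm_pow, Complex.norm_real]
    rw [dist_zero_right, not_lt] at hs
    exact div_le_div₀ hM0 (hM s) (by positivity) (pow_le_pow_left₀ hδ.le hs p)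

theorem integrable_div_pow_add_two {h : ℝ → ℂ} (hh : ContDiff ℝ ∞ h)
    (h0 : h =ᶠ[𝓝 0] 0) {M : ℝ} (hM : ∀ s, ‖h s‖ ≤ M) (p : ℕ) :
    Integrable fun s : ℝ => h s / (s : ℂ) ^ (p + 2) := by
  obtain ⟨M₁, h₁⟩ := exists_norm_div_pow_le h0 hM (p + 2)
  obtain ⟨M₂, h₂⟩ := exists_norm_div_pow_le h0 hM p
  refine (integrable_inv_one_add_sq.const_mul (M₁ + M₂)).mono'
    (contDiff_div_pow_of_eventually_zero hh h0 _).continuous.aestronglyMeasurable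
    (ae_of_all _ fun s => ?_)
  rw [← div_eq_mul_inv, le_div_iff₀ (by positivity)]
  have : s ^ 2 * ‖h s / (s : ℂ) ^ (p + 2)‖ ≤ M₂ := by
    by_cases hs : s = 0
    · subst hs
      simpa using (norm_nonneg _).trans (h₂ 0)
    · refine le_trans (le_of_eq ?_) (h₂ s)
      rw [norm_div, norm_div, norm_pow, norm_pow, Complex.norm_real, pow_add, Real.norm_eq_abs,
        sq_abs]
      field_simp
  nlinarith [h₁ s]

theorem integrable_cexp_neg_mul_sq_mul_of_bounded {z : ℂ} (hz : 0 < z.re) {h : ℝ → ℂ}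
    (hh : Continuous h) {M : ℝ} (hM : ∀ s, ‖h s‖ ≤ M) :
    Integrable fun s : ℝ => Complex.exp (-z * (s : ℂ) ^ 2) * h s :=
  (integrable_cexp_neg_mul_sq hz).mul_bdd hh.aestronglyMeasurable (ae_of_all _ hM)

/-- The part of a Gaussian integral away from the stationary point decays faster than any power
of `z`, uniformly up to the imaginary axis. The amplitude `h` need not decay; each integration by
parts gains a factor `s⁻²`, and the condition `1 ≤ n + j` makes the last amplitude integrable. -/
theorem exists_norm_integral_div_pow_le (n : ℕ) :
    ∀ (h : ℝ → ℂ) (j : ℕ), 1 ≤ n + j → ContDiff ℝ ∞ h → h =ᶠ[𝓝 0] 0 →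
      (∃ M : ℝ, ∀ s, ‖h s‖ ≤ M) → HasCompactSupport (deriv h) → ∃ C : ℝ, ∀ z : ℂ, 0 < z.re →
      ‖∫ s : ℝ, Complex.exp (-z * (s : ℂ) ^ 2) * (h s / (s : ℂ) ^ (2 * j))‖ ≤ C / ‖z‖ ^ n := by
  induction n with
  | zero =>
    rintro h j hj hh h0 ⟨M, hM⟩ hc
    refine ⟨∫ s : ℝ, ‖h s / (s : ℂ) ^ (2 * j)‖, fun z hz => ?_⟩
    simp only [pow_zero, div_one]
    obtain ⟨i, rfl⟩ : ∃ i, j = i + 1 := ⟨j - 1, by omega⟩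
    refine norm_integral_le_of_norm_le
      (integrable_div_pow_add_two hh h0 hM (2 * i)).norm (ae_of_all _ fun s => ?_)
    rw [norm_mul]
    exact mul_le_of_le_one_left (norm_nonneg _) (norm_cexp_neg_mul_sq_le_one hz.le s)
  | succ n ih =>
    rintro h j hj hh h0 ⟨M, hM⟩ hc
    have hh' := contDiff_deriv_infty hh
    have h0' : deriv h =ᶠ[𝓝 0] 0 := by
      have := h0.deriv
      rwa [show deriv (0 : ℝ → ℂ) = 0 from funext fun x => deriv_const x 0] at this
    set r : ℝ → ℂ := fun s : ℝ => s * deriv h s - ((2 * j : ℕ) + 1 : ℂ) * h s with hrdef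
    have hr : ContDiff ℝ ∞ r := (contDiff_ofReal.mul hh').sub (contDiff_const.mul hh)
    have hr0 : r =ᶠ[𝓝 0] 0 := by
      filter_upwards [h0, h0'] with s h1 h2
      simp [hrdef, h1, h2]
    obtain ⟨M₁, hM₁⟩ := (hc.mul_left (f := fun s : ℝ => (s : ℂ))).exists_bound_of_continuous
      (Complex.continuous_ofReal.mul hh'.continuous)
    have hrM : ∀ s, ‖r s‖ ≤ M₁ + ‖((2 * j : ℕ) + 1 : ℂ)‖ * M := by
      intro s
      refine (norm_sub_le _ _).trans (add_le_add (hM₁ s) ?_)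
      rw [norm_mul]
      exact mul_le_mul_of_nonneg_left (hM s) (norm_nonneg _)
    have hrd : ∀ s, deriv r s =
        s * deriv (deriv h) s + (1 - ((2 * j : ℕ) + 1 : ℂ)) * deriv h s := by
      intro s
      have hs : HasDerivAt (fun s : ℝ => (s : ℂ)) 1 s := Complex.ofRealCLM.hasDerivAt
      have hd : HasDerivAt h (deriv h s) s :=
        (hh.differentiable (by simp)).differentiableAt.hasDerivAt
      have hd' : HasDerivAt (deriv h) (deriv (deriv h) s) s :=
        (hh'.differentiable (by simp)).differentiableAt.hasDerivAt
      have := ((hs.mul hd').sub (hd.const_mul ((2 * j : ℕ) + 1 : ℂ))).deriv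
      refine Eq.trans this ?_
      ring
    have hrc : HasCompactSupport (deriv r) := by
      rw [show deriv r = _ from funext hrd]
      exact hc.deriv.mul_left.add hc.mul_left
    obtain ⟨C, hC⟩ := ih r (j + 1) (by omega) hr hr0 ⟨_, hrM⟩ hrc
    refine ⟨C / 2, fun z hz => ?_⟩
    have hd : ∀ s : ℝ, HasDerivAt (fun s : ℝ => h s / (s : ℂ) ^ (2 * j + 1))
        (r s / (s : ℂ) ^ (2 * (j + 1))) s := by
      intro s
      by_cases hs : s = 0
      · subst hs
        rw [hr0.eq_of_nhds]
        refine ((hasDerivAt_const (0 : ℝ) (0 : ℂ)).congr_of_eventuallyEq ?_).congr_deriv (by simp)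
        filter_upwards [h0] with t ht
        simp [ht]
      · have hsc : (s : ℂ) ≠ 0 := by exact_mod_cast hs
        have hs' : HasDerivAt (fun s : ℝ => (s : ℂ)) 1 s := Complex.ofRealCLM.hasDerivAt
        have hd : HasDerivAt h (deriv h s) s :=
          (hh.differentiable (by simp)).differentiableAt.hasDerivAt
        refine (hd.div (hs'.pow (2 * j + 1)) (pow_ne_zero _ hsc)).congr_deriv ?_
        simp only [hrdef, Pi.pow_apply, Nat.add_sub_cancel]
        field_simp
        push_cast
        ring
    have hsg : ∀ s : ℝ, (s : ℂ) * (h s / (s : ℂ) ^ (2 * j + 1)) = h s / (s : ℂ) ^ (2 * j) := by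
      intro s
      by_cases hs : s = 0
      · subst hs
        simp [h0.eq_of_nhds]
      · have hsc : (s : ℂ) ≠ 0 := by exact_mod_cast hs
        field_simp
        ring
    obtain ⟨K₁, hK₁⟩ := exists_norm_div_pow_le h0 hM (2 * j + 1)
    obtain ⟨K₂, hK₂⟩ := exists_norm_div_pow_le h0 hM (2 * j)
    obtain ⟨K₃, hK₃⟩ := exists_norm_div_pow_le hr0 hrM (2 * (j + 1))
    have key := integral_cexp_neg_mul_sq_by_parts (z := z) hd
      (integrable_cexp_neg_mul_sq_mul_of_bounded hz
        (contDiff_div_pow_of_eventually_zero hh h0 _).continuous hK₁)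
      (integrable_cexp_neg_mul_sq_mul_of_bounded hz
        (contDiff_div_pow_of_eventually_zero hr hr0 _).continuous hK₃)
      (by
        simp only [hsg]
        exact integrable_cexp_neg_mul_sq_mul_of_bounded hz
          (contDiff_div_pow_of_eventually_zero hh h0 _).continuous hK₂)
    simp only [hsg] at key
    have h1 := hC z hz
    rw [← key, norm_mul, norm_mul, Complex.norm_ofNat] at h1
    have hzp : 0 < ‖z‖ := norm_pos_iff.mpr (fun h => by simp [h] at hz)
    rw [le_div_iff₀ (by positivity)] at h1 ⊢
    rw [pow_succ]
    linarith

/-! ### Stationary phase for a quadratic phase -/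

theorem contDiff_ofReal_bump (η : ContDiffBump (0 : ℝ)) :
    ContDiff ℝ ∞ fun s : ℝ => ((η s : ℝ) : ℂ) :=
  contDiff_ofReal.comp η.contDiff

theorem hasCompactSupport_ofReal_bump (η : ContDiffBump (0 : ℝ)) :
    HasCompactSupport fun s : ℝ => ((η s : ℝ) : ℂ) :=
  η.hasCompactSupport.comp_left Complex.ofReal_zero

theorem eventually_bump_eq_one (η : ContDiffBump (0 : ℝ)) :
    ∀ᶠ s in 𝓝 (0 : ℝ), ((η s : ℝ) : ℂ) = 1 := by
  filter_upwards [η.eventuallyEq_one] with s hs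
  simp [hs]

theorem eventually_deriv_bump_eq_zero (η : ContDiffBump (0 : ℝ)) :
    deriv (fun s : ℝ => ((η s : ℝ) : ℂ)) =ᶠ[𝓝 0] 0 := by
  have h : (fun s : ℝ => ((η s : ℝ) : ℂ)) =ᶠ[𝓝 0] fun _ => 1 := eventually_bump_eq_one η
  have := h.deriv
  rwa [show deriv (fun _ : ℝ => (1 : ℂ)) = 0 from funext fun x => deriv_const x 1] at this

/-- A cut-off Fresnel integral equals the full one up to an error decaying faster than any power:
the tail is negligible uniformly for `z = ε - i x`, and `ε → 0⁺` in the Gaussian formula. -/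
theorem exists_norm_integral_bump_sub_le (η : ContDiffBump (0 : ℝ)) (n : ℕ) :
    ∃ C : ℝ, ∀ x : ℝ, 1 ≤ x →
      ‖(∫ s : ℝ, Complex.exp (-(-(Complex.I * x)) * (s : ℂ) ^ 2) * (η s : ℂ))
        - (Real.pi / (-(Complex.I * x))) ^ (1 / 2 : ℂ)‖ ≤ C / x ^ n := by
  have hη := contDiff_ofReal_bump η
  have hdiff : ContDiff ℝ ∞ fun s : ℝ => 1 - ((η s : ℝ) : ℂ) := contDiff_const.sub hη
  have hbd : ∀ s : ℝ, ‖1 - ((η s : ℝ) : ℂ)‖ ≤ 1 := by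
    intro s
    rw [← Complex.ofReal_one, ← Complex.ofReal_sub, Complex.norm_real, Real.norm_eq_abs, abs_le]
    constructor <;> linarith [η.nonneg (x := s), η.le_one (x := s)]
  obtain ⟨C, hC⟩ := exists_norm_integral_div_pow_le (n + 1) (fun s => 1 - ((η s : ℝ) : ℂ)) 0
    (by omega) hdiff
    (by filter_upwards [eventually_bump_eq_one η] with s hs; simp [hs])
    ⟨1, hbd⟩
    (by
      have : deriv (fun s : ℝ => 1 - ((η s : ℝ) : ℂ)) = fun s => -deriv (fun s => (η s : ℂ)) s := by
        funext s; exact deriv_const_sub _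
      rw [this]
      exact (hasCompactSupport_ofReal_bump η).deriv.neg)
  refine ⟨C, fun x hx => ?_⟩
  have hx0 : 0 < x := by linarith
  set z : ℝ → ℂ := fun ε => ε - Complex.I * x with hz
  have hzre : ∀ ε, (z ε).re = ε := by intro ε; simp [hz]
  have hznorm : ∀ ε, x ≤ ‖z ε‖ := by
    intro ε
    refine le_trans ?_ (Complex.abs_im_le_norm _)
    simp [hz, abs_of_pos hx0]
  have hz0 : z 0 = -(Complex.I * x) := by simp [hz]
  have hzc : Continuous z := by fun_prop
  have hL : Tendsto (fun ε : ℝ => ∫ s : ℝ, Complex.exp (-(z ε) * (s : ℂ) ^ 2) * (η s : ℂ))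
      (𝓝[>] 0) (𝓝 (∫ s : ℝ, Complex.exp (-(z 0) * (s : ℂ) ^ 2) * (η s : ℂ))) := by
    refine tendsto_integral_filter_of_dominated_convergence (fun s => ‖(η s : ℂ)‖) ?_ ?_ ?_ ?_
    · refine Eventually.of_forall fun ε => Continuous.aestronglyMeasurable ?_
      exact (by fun_prop : Continuous fun s : ℝ => Complex.exp (-(z ε) * (s : ℂ) ^ 2)).mul
        hη.continuous
    · filter_upwards [self_mem_nhdsWithin] with ε hε
      refine ae_of_all _ fun s => ?_
      rw [norm_mul]
      refine mul_le_of_le_one_left (norm_nonneg _) (norm_cexp_neg_mul_sq_le_one ?_ s)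
      rw [hzre]; exact (Set.mem_Ioi.mp hε).le
    · exact (hη.continuous.integrable_of_hasCompactSupport
        (hasCompactSupport_ofReal_bump η)).norm
    · refine ae_of_all _ fun s => ?_
      have : Continuous fun ε : ℝ => Complex.exp (-(z ε) * (s : ℂ) ^ 2) * (η s : ℂ) := by fun_prop
      exact (this.tendsto 0).mono_left nhdsWithin_le_nhds
  have hR : Tendsto (fun ε : ℝ => (Real.pi / z ε) ^ (1 / 2 : ℂ)) (𝓝[>] 0)
      (𝓝 ((Real.pi / z 0) ^ (1 / 2 : ℂ))) := by
    have hne : z 0 ≠ 0 := norm_pos_iff.mp (hx0.trans_le (hznorm 0))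
    have hslit : (Real.pi : ℂ) / z 0 ∈ Complex.slitPlane := by
      right
      rw [hz0, show (Real.pi : ℂ) / (-(Complex.I * x)) = ((Real.pi / x : ℝ) : ℂ) * Complex.I by
        have : (x : ℂ) ≠ 0 := by exact_mod_cast hx0.ne'
        push_cast
        field_simp
        simp]
      simpa using hx0.ne'
    exact ((continuousAt_const.div hzc.continuousAt hne).cpow continuousAt_const hslit
      ).tendsto.mono_left nhdsWithin_le_nhds
  rw [← hz0]
  refine le_of_tendsto (hL.sub hR).norm ?_
  filter_upwards [self_mem_nhdsWithin] with ε hε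
  have hεre : 0 < (z ε).re := by rw [hzre]; exact hε
  have hsplit : (∫ s : ℝ, Complex.exp (-(z ε) * (s : ℂ) ^ 2) * (η s : ℂ))
      - (Real.pi / z ε) ^ (1 / 2 : ℂ) =
      -∫ s : ℝ, Complex.exp (-(z ε) * (s : ℂ) ^ 2) * ((1 - (η s : ℂ)) / (s : ℂ) ^ (2 * 0)) := by
    rw [← integral_gaussian_complex hεre, ← integral_sub
      (integrable_cexp_neg_mul_sq_mul_of_hasCompactSupport _ hη.continuous
        (hasCompactSupport_ofReal_bump η)) (integrable_cexp_neg_mul_sq hεre), ← integral_neg]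
    congr 1
    funext s
    simp
    ring
  rw [hsplit, norm_neg]
  have h1 := hC (z ε) hεre
  have hC0 : 0 ≤ C := by
    have h2 := (norm_nonneg _).trans h1
    have h3 : 0 < ‖z ε‖ ^ (n + 1) := pow_pos (hx0.trans_le (hznorm ε)) _
    by_contra hneg
    exact absurd h2 (not_le.mpr (div_neg_of_neg_of_pos (not_le.mp hneg) h3))
  refine h1.trans (div_le_div_of_nonneg_left hC0 (by positivity) ?_)
  calc x ^ n ≤ x ^ (n + 1) := pow_le_pow_right₀ hx (by omega)
    _ ≤ ‖z ε‖ ^ (n + 1) := pow_le_pow_left₀ hx0.le (hznorm ε) _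

/-- The value of `∫ exp (-z s²) s^{2k} ds`, namely `√(π/z) (1/2)ₖ z⁻ᵏ`, at `z = -i x`, where it is
understood by analytic continuation. -/
noncomputable def fresnelMoment (k : ℕ) (x : ℝ) : ℂ :=
  (Real.pi / (-(Complex.I * x))) ^ (1 / 2 : ℂ) * (poch (1 / 2) k : ℂ) / (-(Complex.I * x)) ^ k

theorem poch_succ (c : ℝ) (n : ℕ) : poch c (n + 1) = poch c n * (c + n) :=
  ascPochhammer_succ_eval n c

/-- The cut-off moments. Integration by parts gives the recursion of the full moments, up to a term
with the derivative of the cut-off, which vanishes near `0` and is therefore negligible. -/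
theorem exists_norm_integral_pow_mul_bump_sub_le (η : ContDiffBump (0 : ℝ)) (n k : ℕ) :
    ∃ C : ℝ, ∀ x : ℝ, 1 ≤ x →
      ‖(∫ s : ℝ, Complex.exp (-(-(Complex.I * x)) * (s : ℂ) ^ 2) * ((s : ℂ) ^ (2 * k) * (η s : ℂ)))
        - fresnelMoment k x‖ ≤ C / x ^ n := by
  have hη := contDiff_ofReal_bump η
  have hηc := hasCompactSupport_ofReal_bump η
  induction k with
  | zero =>
    simpa [fresnelMoment, poch] using exists_norm_integral_bump_sub_le η n
  | succ k ih =>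
    obtain ⟨C₁, hC₁⟩ := ih
    set ρ : ℝ → ℂ := fun s => (s : ℂ) ^ (2 * k + 1) *
      (deriv (fun s : ℝ => ((η s : ℝ) : ℂ)) s / (s : ℂ) ^ (2 * n)) with hρ
    have hρd : ContDiff ℝ ∞ ρ := (contDiff_ofReal.pow _).mul
      (contDiff_div_pow_of_eventually_zero (contDiff_deriv_infty hη)
        (eventually_deriv_bump_eq_zero η) _)
    have hρc : HasCompactSupport ρ := by
      refine HasCompactSupport.mul_left ?_
      simp only [div_eq_mul_inv]
      exact hηc.deriv.mul_right
    have hρs : ∀ s : ℝ, (s : ℂ) ^ (2 * n) * ρ s =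
        (s : ℂ) ^ (2 * k) * (s * deriv (fun s : ℝ => ((η s : ℝ) : ℂ)) s) := by
      intro s
      by_cases hs : s = 0
      · subst hs
        simp [hρ, (eventually_deriv_bump_eq_zero η).eq_of_nhds]
      · have : (s : ℂ) ≠ 0 := by exact_mod_cast hs
        simp only [hρ]
        field_simp
        ring
    obtain ⟨C₂, hC₂⟩ := exists_norm_integral_pow_mul_le n ρ hρd hρc
    refine ⟨((2 * k + 1) * C₁ + C₂) / 2, fun x hx => ?_⟩
    have hx0 : 0 < x := by linarith
    set z : ℂ := -(Complex.I * x) with hz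
    have hzn : ‖z‖ = x := by simp [hz, abs_of_pos hx0]
    have hz0 : z ≠ 0 := by rw [← norm_pos_iff, hzn]; exact hx0
    have hzre : 0 ≤ z.re := by simp [hz]
    have hcont := Complex.continuous_ofReal
    have hη' := (contDiff_deriv_infty hη).continuous
    have key := integral_cexp_neg_mul_sq_by_parts (z := z)
      (fun s => hasDerivAt_ofReal_pow_succ_mul hη (2 * k) s)
      (integrable_cexp_neg_mul_sq_mul_of_hasCompactSupport z
        ((hcont.pow _).mul hη.continuous) hηc.mul_left)
      (integrable_cexp_neg_mul_sq_mul_of_hasCompactSupport z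
        ((hcont.pow _).mul ((continuous_const.mul hη.continuous).add (hcont.mul hη')))
        ((hηc.mul_left.add hηc.deriv.mul_left).mul_left))
      (integrable_cexp_neg_mul_sq_mul_of_hasCompactSupport z
        (hcont.mul ((hcont.pow _).mul hη.continuous)) (hηc.mul_left.mul_left))
    have hsplit : ∫ s : ℝ, Complex.exp (-z * (s : ℂ) ^ 2) * ((s : ℂ) ^ (2 * k) *
          (((2 * k : ℕ) + 1 : ℂ) * (η s : ℂ) + s * deriv (fun s : ℝ => ((η s : ℝ) : ℂ)) s)) =
        (2 * k + 1 : ℂ) * (∫ s : ℝ, Complex.exp (-z * (s : ℂ) ^ 2) *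
          ((s : ℂ) ^ (2 * k) * (η s : ℂ))) +
        ∫ s : ℝ, Complex.exp (-z * (s : ℂ) ^ 2) * ((s : ℂ) ^ (2 * n) * ρ s) := by
      rw [← integral_const_mul, ← integral_add]
      · congr 1
        funext s
        rw [hρs]
        push_cast
        ring
      · exact (integrable_cexp_neg_mul_sq_mul_of_hasCompactSupport z
          ((hcont.pow _).mul hη.continuous) hηc.mul_left).const_mul _
      · exact integrable_cexp_neg_mul_sq_mul_of_hasCompactSupport z
          ((hcont.pow _).mul hρd.continuous) hρc.mul_left
    rw [hsplit] at key
    have h1 := hC₁ x hx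
    have h2 := hC₂ z hz0 hzre
    rw [hzn] at h2
    have hmom : 2 * z * fresnelMoment (k + 1) x = (2 * k + 1) * fresnelMoment k x := by
      simp only [fresnelMoment, poch_succ, ← hz]
      push_cast
      field_simp
      ring
    have hpow : ∀ s : ℝ, (s : ℂ) ^ (2 * (k + 1)) * (η s : ℂ) =
        s * ((s : ℂ) ^ (2 * k + 1) * (η s : ℂ)) := by intro s; ring
    simp only [hpow]
    set X := ∫ s : ℝ, Complex.exp (-z * (s : ℂ) ^ 2) * (s * ((s : ℂ) ^ (2 * k + 1) * (η s : ℂ)))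
    set Y := ∫ s : ℝ, Complex.exp (-z * (s : ℂ) ^ 2) * ((s : ℂ) ^ (2 * k) * (η s : ℂ))
    set W := ∫ s : ℝ, Complex.exp (-z * (s : ℂ) ^ 2) * ((s : ℂ) ^ (2 * n) * ρ s)
    have h3 : 2 * z * (X - fresnelMoment (k + 1) x) =
        (2 * k + 1) * (Y - fresnelMoment k x) + W := by
      linear_combination key - hmom
    have h4 : 2 * x * ‖X - fresnelMoment (k + 1) x‖ ≤ (2 * k + 1) * (C₁ / x ^ n) + C₂ / x ^ n := by
      calc 2 * x * ‖X - fresnelMoment (k + 1) x‖ = ‖2 * z * (X - fresnelMoment (k + 1) x)‖ := by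
            rw [norm_mul, norm_mul, Complex.norm_ofNat, hzn]
        _ ≤ ‖(2 * k + 1 : ℂ)‖ * ‖Y - fresnelMoment k x‖ + ‖W‖ := by
            rw [h3, ← norm_mul]; exact norm_add_le _ _
        _ ≤ _ := by
            have : ‖(2 * k + 1 : ℂ)‖ = 2 * k + 1 := by
              rw [show (2 * k + 1 : ℂ) = ((2 * k + 1 : ℝ) : ℂ) by push_cast; rfl,
                Complex.norm_real, Real.norm_of_nonneg (by positivity)]
            rw [this]
            gcongr
    have h5 : 2 * ‖X - fresnelMoment (k + 1) x‖ ≤ 2 * x * ‖X - fresnelMoment (k + 1) x‖ := by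
      nlinarith [norm_nonneg (X - fresnelMoment (k + 1) x)]
    have h6 : ((2 * k + 1) * C₁ + C₂) / 2 / x ^ n =
        ((2 * k + 1) * (C₁ / x ^ n) + C₂ / x ^ n) / 2 := by ring
    rw [h6]
    linarith

theorem integral_odd_pow_mul_bump_eq_zero (η : ContDiffBump (0 : ℝ)) (k : ℕ) (z : ℂ) :
    ∫ s : ℝ, Complex.exp (-z * (s : ℂ) ^ 2) * ((s : ℂ) ^ (2 * k + 1) * (η s : ℂ)) = 0 := by
  have h := integral_neg_eq_self
    (fun s : ℝ => Complex.exp (-z * (s : ℂ) ^ 2) * ((s : ℂ) ^ (2 * k + 1) * (η s : ℂ))) volume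
  have h2 : ∀ s : ℝ, Complex.exp (-z * ((-s : ℝ) : ℂ) ^ 2) *
      (((-s : ℝ) : ℂ) ^ (2 * k + 1) * (η (-s) : ℂ)) =
      -(Complex.exp (-z * (s : ℂ) ^ 2) * ((s : ℂ) ^ (2 * k + 1) * (η s : ℂ))) := by
    intro s
    rw [η.neg]
    push_cast
    rw [neg_sq, Odd.neg_pow ⟨k, rfl⟩]
    ring
  simp only [h2, integral_neg] at h
  exact neg_eq_self.mp h

theorem sum_range_two_mul {M : Type*} [AddCommMonoid M] (f : ℕ → M) (K : ℕ) :
    ∑ i ∈ Finset.range (2 * K), f i = ∑ k ∈ Finset.range K, (f (2 * k) + f (2 * k + 1)) := by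
  induction K with
  | zero => simp
  | succ K ih =>
    rw [Finset.sum_range_succ, ← ih, show 2 * (K + 1) = 2 * K + 1 + 1 by ring,
      Finset.sum_range_succ, Finset.sum_range_succ, add_assoc]

/-- Stationary phase with a quadratic phase: only the even Taylor coefficients at the stationary
point contribute. The Taylor remainder, divided by `s^{2K}`, is again smooth with compact
support, so it contributes `O(x⁻ᴷ)`. -/
theorem exists_norm_integral_sub_sum_fresnelMoment_le {G : ℝ → ℂ} (hG : ContDiff ℝ ∞ G)
    (hGc : HasCompactSupport G) {F : ℂ → ℂ} (hF : AnalyticAt ℂ F 0)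
    (hGF : ∀ᶠ s in 𝓝 (0 : ℝ), G s = F s) (K : ℕ) :
    ∃ C : ℝ, ∀ x : ℝ, 1 ≤ x →
      ‖(∫ s : ℝ, Complex.exp (-(-(Complex.I * x)) * (s : ℂ) ^ 2) * G s)
        - ∑ k ∈ Finset.range K,
          iteratedDeriv (2 * k) F 0 / ((2 * k).factorial : ℂ) * fresnelMoment k x‖ ≤ C / x ^ K := by
  obtain ⟨R, hR, hFR⟩ := hF.exists_eq_sum_add_pow_mul (2 * K)
  let η : ContDiffBump (0 : ℝ) := ⟨1, 2, one_pos, one_lt_two⟩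
  have hη := contDiff_ofReal_bump η
  have hηc := hasCompactSupport_ofReal_bump η
  set c : ℕ → ℂ := fun i => iteratedDeriv i F 0 / (i.factorial : ℂ) with hc
  have hFR' : ∀ z, F z = (∑ i ∈ Finset.range (2 * K), c i * z ^ i) + z ^ (2 * K) * R z := by
    intro z
    rw [hFR z, smul_eq_mul]
    congr 1
    refine Finset.sum_congr rfl fun i _ => ?_
    simp only [hc, smul_eq_mul]
    ring
  set P : ℝ → ℂ := fun s => ∑ i ∈ Finset.range (2 * K), c i * (s : ℂ) ^ i with hP
  have hPd : ContDiff ℝ ∞ P := ContDiff.sum fun i _ => contDiff_const.mul (contDiff_ofReal.pow i)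
  set ρ : ℝ → ℂ := fun s => if s = 0 then R 0 else (G s - P s * (η s : ℂ)) / (s : ℂ) ^ (2 * K)
    with hρ
  have hsplit : ∀ s : ℝ, G s = P s * (η s : ℂ) + (s : ℂ) ^ (2 * K) * ρ s := by
    intro s
    by_cases hs : s = 0
    · subst hs
      rw [hGF.self_of_nhds, hFR', (eventually_bump_eq_one η).self_of_nhds]
      simp [hρ, hP]
    · have : (s : ℂ) ≠ 0 := by exact_mod_cast hs
      simp only [hρ, if_neg hs]
      field_simp
      ring
  have hρd : ContDiff ℝ ∞ ρ := by
    rw [contDiff_iff_contDiffAt]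
    intro s
    by_cases hs : s = 0
    · subst hs
      have h1 : ContDiffAt ℝ ∞ (fun s : ℝ => R s) 0 := by
        have h2 : ContDiffAt ℝ ∞ R ((0 : ℝ) : ℂ) := by
          rw [Complex.ofReal_zero]
          exact (hR.contDiffAt (n := ∞)).restrict_scalars ℝ
        exact h2.comp (0 : ℝ) contDiff_ofReal.contDiffAt
      refine h1.congr_of_eventuallyEq ?_
      filter_upwards [hGF, eventually_bump_eq_one η] with s h3 h4
      by_cases hs : s = 0
      · simp [hρ, hs]
      · have : (s : ℂ) ≠ 0 := by exact_mod_cast hs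
        simp only [hρ, if_neg hs, h3, h4, hFR' s, hP]
        field_simp
        ring
    · have h2 : ContDiffAt ℝ ∞ (fun s : ℝ => (s : ℂ) ^ (2 * K)) s :=
        (contDiff_ofReal.pow _).contDiffAt
      refine ContDiffAt.congr_of_eventuallyEq (f := fun s : ℝ =>
        (G s - P s * (η s : ℂ)) * ((s : ℂ) ^ (2 * K))⁻¹)
        ((hG.sub (hPd.mul hη)).contDiffAt.mul
          (h2.inv (pow_ne_zero _ (by exact_mod_cast hs)))) ?_
      filter_upwards [isOpen_ne.mem_nhds hs] with t ht
      simp only [hρ, if_neg ht, div_eq_mul_inv]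
  have hρc : HasCompactSupport ρ := by
    refine HasCompactSupport.intro (hGc.isCompact.union hηc.isCompact) fun s hs => ?_
    rw [Set.mem_union, not_or] at hs
    have h1 : G s = 0 := image_eq_zero_of_notMem_tsupport hs.1
    have h2 : (η s : ℂ) = 0 := image_eq_zero_of_notMem_tsupport (f := fun s => ((η s : ℝ) : ℂ)) hs.2
    have h3 : s ≠ 0 := by
      rintro rfl
      rw [(eventually_bump_eq_one η).self_of_nhds] at h2
      exact one_ne_zero h2
    simp [hρ, h1, h2, h3]
  obtain ⟨C₀, hC₀⟩ := exists_norm_integral_pow_mul_le K ρ hρd hρc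
  choose C hC using fun k => exists_norm_integral_pow_mul_bump_sub_le η K k
  refine ⟨∑ k ∈ Finset.range K, ‖c (2 * k)‖ * C k + C₀, fun x hx => ?_⟩
  have hx0 : 0 < x := by linarith
  have hzn : ‖-(Complex.I * x)‖ = x := by simp [abs_of_pos hx0]
  have hz0 : -(Complex.I * x) ≠ 0 := by rw [← norm_pos_iff, hzn]; exact hx0
  have h0 := hC₀ (-(Complex.I * x)) hz0 (by simp)
  rw [hzn] at h0
  set z : ℂ := -(Complex.I * x) with hz
  have hint : ∀ i : ℕ, Integrable fun s : ℝ =>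
      Complex.exp (-z * (s : ℂ) ^ 2) * ((s : ℂ) ^ i * (η s : ℂ)) := fun i =>
    integrable_cexp_neg_mul_sq_mul_of_hasCompactSupport z
      ((Complex.continuous_ofReal.pow _).mul hη.continuous) hηc.mul_left
  have hI : ∫ s : ℝ, Complex.exp (-z * (s : ℂ) ^ 2) * G s =
      (∑ k ∈ Finset.range K, c (2 * k) *
        ∫ s : ℝ, Complex.exp (-z * (s : ℂ) ^ 2) * ((s : ℂ) ^ (2 * k) * (η s : ℂ))) +
      ∫ s : ℝ, Complex.exp (-z * (s : ℂ) ^ 2) * ((s : ℂ) ^ (2 * K) * ρ s) := by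
    have h1 : ∀ s : ℝ, Complex.exp (-z * (s : ℂ) ^ 2) * G s =
        (∑ i ∈ Finset.range (2 * K), c i *
          (Complex.exp (-z * (s : ℂ) ^ 2) * ((s : ℂ) ^ i * (η s : ℂ)))) +
        Complex.exp (-z * (s : ℂ) ^ 2) * ((s : ℂ) ^ (2 * K) * ρ s) := by
      intro s
      rw [hsplit s, mul_add, hP, Finset.sum_mul, Finset.mul_sum]
      congr 1
      refine Finset.sum_congr rfl fun i _ => ?_
      ring
    simp only [h1]
    rw [integral_add (integrable_finsetSum _ fun i _ => (hint i).const_mul _)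
      (integrable_cexp_neg_mul_sq_mul_of_hasCompactSupport z
        (h := fun s => (s : ℂ) ^ (2 * K) * ρ s)
        ((Complex.continuous_ofReal.pow _).mul hρd.continuous) hρc.mul_left),
      integral_finsetSum _ fun i _ => (hint i).const_mul _]
    congr 1
    rw [sum_range_two_mul]
    refine Finset.sum_congr rfl fun k _ => ?_
    rw [integral_const_mul, integral_const_mul, integral_odd_pow_mul_bump_eq_zero, mul_zero,
      add_zero]
  rw [hI, add_sub_right_comm, ← Finset.sum_sub_distrib, add_div, Finset.sum_div]
  refine (norm_add_le _ _).trans (add_le_add ((norm_sum_le _ _).trans ?_) h0)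
  refine Finset.sum_le_sum fun k _ => ?_
  rw [← mul_sub, norm_mul, mul_div_assoc]
  exact mul_le_mul_of_nonneg_left (hC k x hx) (norm_nonneg _)

/-! ### The real phase away from its stationary points -/

theorem tan_saddle (a : ℝ) : Real.tan (saddle a) = Real.sqrt (a - 1) := Real.tan_arctan _

theorem saddle_mem (a : ℝ) : saddle a ∈ Set.Ioo (-(Real.pi / 2)) (Real.pi / 2) :=
  ⟨Real.neg_pi_div_two_lt_arctan _, Real.arctan_lt_pi_div_two _⟩

theorem saddle_pos {a : ℝ} (ha : 1 < a) : 0 < saddle a :=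
  Real.arctan_pos.mpr (Real.sqrt_pos.mpr (by linarith))

theorem eq_saddle_or_eq_neg_saddle {a u : ℝ} (ha : 1 < a)
    (hu : u ∈ Set.Icc (-(Real.pi / 2)) (Real.pi / 2)) (h : 1 - a * Real.cos u ^ 2 = 0) :
    u = saddle a ∨ u = -saddle a := by
  have hc : Real.cos u ≠ 0 := by
    intro hc
    simp [hc] at h
  have hu' : u ∈ Set.Ioo (-(Real.pi / 2)) (Real.pi / 2) := by
    refine ⟨lt_of_le_of_ne hu.1 ?_, lt_of_le_of_ne hu.2 ?_⟩
    · rintro rfl; simp at hc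
    · rintro rfl; simp at hc
  have ht : Real.tan u ^ 2 = a - 1 := by
    have h1 := Real.sin_sq_add_cos_sq u
    rw [Real.tan_eq_sin_div_cos, div_pow]
    field_simp
    linear_combination h1 + h
  have hs : Real.sqrt (a - 1) ^ 2 = a - 1 := Real.sq_sqrt (by linarith)
  rcases sq_eq_sq_iff_eq_or_eq_neg.mp (ht.trans hs.symm) with h2 | h2
  · left
    rw [saddle, ← h2, Real.arctan_tan hu'.1 hu'.2]
  · right
    rw [saddle, ← neg_eq_iff_eq_neg.mpr h2, Real.arctan_neg, Real.arctan_tan hu'.1 hu'.2, neg_neg]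

theorem contDiffAt_deriv_infty {h : ℝ → ℂ} {u : ℝ} (hh : ContDiffAt ℝ ∞ h u) :
    ContDiffAt ℝ ∞ (deriv h) u := by
  have h1 : ContDiffAt ℝ ∞ (fderiv ℝ h) u := hh.fderiv_right (by simp)
  exact h1.clm_apply contDiffAt_const

/-- The reciprocal `cos² u / (1 - a cos² u)` of the derivative of the phase `tan u - a u`. It is
smooth and vanishes at `± π/2`. -/
noncomputable def invPhaseDeriv (a u : ℝ) : ℝ :=
  Real.cos u ^ 2 / (1 - a * Real.cos u ^ 2)

theorem contDiffAt_invPhaseDeriv {a u : ℝ} (h : 1 - a * Real.cos u ^ 2 ≠ 0) :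
    ContDiffAt ℝ ∞ (fun u => ((invPhaseDeriv a u : ℝ) : ℂ)) u := by
  have h1 : ContDiffAt ℝ ∞ (invPhaseDeriv a) u :=
    (Real.contDiff_cos.pow 2).contDiffAt.div
      (contDiff_const.sub (contDiff_const.mul (Real.contDiff_cos.pow 2))).contDiffAt h
  exact contDiff_ofReal.contDiffAt.comp u h1

theorem hasDerivAt_phase {a u : ℝ} (hu : Real.cos u ≠ 0) :
    HasDerivAt (fun u => Real.tan u - a * u) ((1 - a * Real.cos u ^ 2) / Real.cos u ^ 2) u := by
  refine ((Real.hasDerivAt_tan hu).sub ((hasDerivAt_id u).const_mul a)).congr_deriv ?_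
  field_simp

theorem cos_ne_zero_of_mem_Ioo {u : ℝ} (hu : u ∈ Set.Ioo (-(Real.pi / 2)) (Real.pi / 2)) :
    Real.cos u ≠ 0 := (Real.cos_pos_of_mem_Ioo hu).ne'

theorem measurable_cexp_phase (a x : ℝ) :
    Measurable fun u : ℝ => Complex.exp (Complex.I * (x * (Real.tan u - a * u) : ℝ)) := by
  have : Measurable Real.tan := by
    simp only [funext Real.tan_eq_sin_div_cos]
    exact Real.measurable_sin.div Real.measurable_cos
  fun_prop

theorem norm_cexp_I_mul_ofReal (t : ℝ) : ‖Complex.exp (Complex.I * (t : ℂ))‖ = 1 := by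
  rw [mul_comm, Complex.norm_exp_ofReal_mul_I]

theorem intervalIntegrable_cexp_phase_mul {h : ℝ → ℂ} {b c : ℝ} (a x : ℝ)
    (hh : ContinuousOn h (Set.uIcc b c)) :
    IntervalIntegrable
      (fun u => Complex.exp (Complex.I * (x * (Real.tan u - a * u) : ℝ)) * h u) volume b c := by
  refine hh.intervalIntegrable.norm.mono_fun' ?_ ?_
  · exact (measurable_cexp_phase a x).aestronglyMeasurable.mul
      (intervalIntegrable_iff.mp hh.intervalIntegrable).aestronglyMeasurable
  · refine ae_of_all _ fun u => ?_
    simp only [norm_mul, norm_cexp_I_mul_ofReal, one_mul, le_refl]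

/-- Nonstationary phase: an amplitude that vanishes near both stationary points contributes less
than any power of `1 / x`. The essential oscillation at `± π/2` leaves no boundary terms, because
the reciprocal of the phase derivative vanishes there. -/
theorem exists_norm_integral_phase_le {a : ℝ} (ha : 1 < a) (n : ℕ) :
    ∀ h : ℝ → ℂ, (∀ u ∈ Set.Icc (-(Real.pi / 2)) (Real.pi / 2), ContDiffAt ℝ ∞ h u) →
      h =ᶠ[𝓝 (saddle a)] 0 → h =ᶠ[𝓝 (-saddle a)] 0 → ∃ C : ℝ, ∀ x : ℝ, 0 < x →
      ‖∫ u in (-(Real.pi / 2))..(Real.pi / 2),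
        Complex.exp (Complex.I * (x * (Real.tan u - a * u) : ℝ)) * h u‖ ≤ C / x ^ n := by
  have hpi : -(Real.pi / 2) ≤ Real.pi / 2 := by linarith [Real.pi_pos]
  induction n with
  | zero =>
    intro h hh _ _
    refine ⟨∫ u in (-(Real.pi / 2))..(Real.pi / 2), ‖h u‖, fun x _ => ?_⟩
    rw [pow_zero, div_one]
    refine (intervalIntegral.norm_integral_le_integral_norm hpi).trans (le_of_eq ?_)
    simp only [norm_mul, norm_cexp_I_mul_ofReal, one_mul]
  | succ n ih =>
    intro h hh h1 h2
    set G : ℝ → ℂ := fun u => h u * (invPhaseDeriv a u : ℂ) with hG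
    have hG1 : G =ᶠ[𝓝 (saddle a)] fun _ => 0 := by
      filter_upwards [h1] with u hu
      simp [hG, hu]
    have hG2 : G =ᶠ[𝓝 (-saddle a)] fun _ => 0 := by
      filter_upwards [h2] with u hu
      simp [hG, hu]
    have hGd : ∀ u ∈ Set.Icc (-(Real.pi / 2)) (Real.pi / 2), ContDiffAt ℝ ∞ G u := by
      intro u hu
      by_cases hne : 1 - a * Real.cos u ^ 2 = 0
      · rcases eq_saddle_or_eq_neg_saddle ha hu hne with rfl | rfl
        · exact contDiffAt_const.congr_of_eventuallyEq hG1
        · exact contDiffAt_const.congr_of_eventuallyEq hG2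
      · exact (hh u hu).mul (contDiffAt_invPhaseDeriv hne)
    have hzero : deriv (fun _ : ℝ => (0 : ℂ)) = 0 := funext fun u => deriv_const u 0
    have hG1' := hG1.deriv
    have hG2' := hG2.deriv
    rw [hzero] at hG1' hG2'
    obtain ⟨C, hC⟩ := ih (deriv G) (fun u hu => contDiffAt_deriv_infty (hGd u hu)) hG1' hG2'
    refine ⟨C, fun x hx => ?_⟩
    set e : ℝ → ℂ := fun u => Complex.exp (Complex.I * (x * (Real.tan u - a * u) : ℝ)) with he
    have hde : ∀ u ∈ Set.Ioo (-(Real.pi / 2)) (Real.pi / 2), HasDerivAt e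
        (e u * (Complex.I * (x * ((1 - a * Real.cos u ^ 2) / Real.cos u ^ 2) : ℝ))) u := by
      intro u hu
      have hphase := hasDerivAt_phase (a := a) (cos_ne_zero_of_mem_Ioo hu)
      exact ((hphase.const_mul x).ofReal_comp.const_mul Complex.I).cexp
    have hd : ∀ u ∈ Set.Ioo (-(Real.pi / 2)) (Real.pi / 2), HasDerivAt (fun u => e u * G u)
        (Complex.I * x * (e u * h u) + e u * deriv G u) u := by
      intro u hu
      have hGu : HasDerivAt G (deriv G u) u :=
        ((hGd u (Set.Ioo_subset_Icc_self hu)).differentiableAt (by simp)).hasDerivAt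
      refine ((hde u hu).mul hGu).congr_deriv ?_
      have hfG : (((1 - a * Real.cos u ^ 2) / Real.cos u ^ 2 : ℝ) : ℂ) * G u = h u := by
        by_cases hne : 1 - a * Real.cos u ^ 2 = 0
        · rcases eq_saddle_or_eq_neg_saddle ha (Set.Ioo_subset_Icc_self hu) hne with rfl | rfl
          · simp [hG1.eq_of_nhds, h1.eq_of_nhds]
          · simp [hG2.eq_of_nhds, h2.eq_of_nhds]
        · have hcos := cos_ne_zero_of_mem_Ioo hu
          have : (1 - a * Real.cos u ^ 2) / Real.cos u ^ 2 * invPhaseDeriv a u = 1 := by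
            rw [invPhaseDeriv]; field_simp
          simp only [hG]
          rw [mul_left_comm, ← Complex.ofReal_mul, this, Complex.ofReal_one, mul_one]
      rw [← hfG]
      push_cast
      ring
    have hcont : ContinuousOn (fun u => e u * G u) (Set.Icc (-(Real.pi / 2)) (Real.pi / 2)) := by
      intro u hu
      by_cases hcos : Real.cos u = 0
      · -- at the end points `e` is discontinuous but bounded, and `G` vanishes
        have hGu : G u = 0 := by
          have : invPhaseDeriv a u = 0 := by rw [invPhaseDeriv, hcos]; simp
          simp only [hG, this, Complex.ofReal_zero, mul_zero]
        have hlim : Tendsto G (𝓝 u) (𝓝 0) := hGu ▸ (hGd u hu).continuousAt.tendsto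
        refine ContinuousAt.continuousWithinAt ?_
        rw [ContinuousAt, hGu, mul_zero]
        refine squeeze_zero_norm (fun v => ?_) (by simpa using hlim.norm)
        rw [norm_mul, he, norm_cexp_I_mul_ofReal, one_mul]
      · have hu' : u ∈ Set.Ioo (-(Real.pi / 2)) (Real.pi / 2) := by
          refine ⟨lt_of_le_of_ne hu.1 ?_, lt_of_le_of_ne hu.2 ?_⟩
          · rintro rfl; simp at hcos
          · rintro rfl; simp at hcos
        exact (hd u hu').continuousAt.continuousWithinAt
    have hi1 : IntervalIntegrable (fun u => e u * h u) volume (-(Real.pi / 2)) (Real.pi / 2) :=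
      intervalIntegrable_cexp_phase_mul a x (by
        rw [Set.uIcc_of_le hpi]
        exact fun u hu => (hh u hu).continuousAt.continuousWithinAt)
    have hi2 : IntervalIntegrable (fun u => e u * deriv G u) volume
        (-(Real.pi / 2)) (Real.pi / 2) :=
      intervalIntegrable_cexp_phase_mul a x (by
        rw [Set.uIcc_of_le hpi]
        exact fun u hu => (contDiffAt_deriv_infty (hGd u hu)).continuousAt.continuousWithinAt)
    have key := intervalIntegral.integral_eq_sub_of_hasDerivAt_of_le hpi hcont hd
      ((hi1.const_mul _).add hi2)
    rw [intervalIntegral.integral_add (hi1.const_mul _) hi2,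
      intervalIntegral.integral_const_mul] at key
    have hend :
        e (Real.pi / 2) * G (Real.pi / 2) - e (-(Real.pi / 2)) * G (-(Real.pi / 2)) = 0 := by
      simp [hG, invPhaseDeriv]
    rw [hend] at key
    have h3 := hC x hx
    rw [← norm_neg, ← eq_neg_of_add_eq_zero_left key, norm_mul, norm_mul, Complex.norm_I, one_mul,
      Complex.norm_real, Real.norm_of_nonneg hx.le] at h3
    rw [le_div_iff₀ (by positivity)] at h3 ⊢
    rw [pow_succ]
    linarith

/-! ### The local coordinate at a quadratic critical point -/

/-- Near a nondegenerate critical point an analytic function is the square of a coordinate, and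
this coordinate is determined, as a germ, by its derivative at the critical point. Writing
`F = (γ (u - u₀))² H` with `H u₀ = 1`, the coordinate is the local inverse of `γ (u - u₀) √H`. -/
theorem exists_unique_quadratic_coordinate {F : ℂ → ℂ} {u₀ γ : ℂ} (hF : AnalyticAt ℂ F u₀)
    (h0 : F u₀ = 0) (h1 : deriv F u₀ = 0) (hγ : γ ≠ 0) (h2 : iteratedDeriv 2 F u₀ = 2 * γ ^ 2) :
    ∃ U : ℂ → ℂ, (AnalyticAt ℂ U 0 ∧ U 0 = u₀ ∧ deriv U 0 = γ⁻¹ ∧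
        ∀ᶠ s in 𝓝 0, F (U s) = s ^ 2) ∧
      ∀ W : ℂ → ℂ, AnalyticAt ℂ W 0 → W 0 = u₀ → deriv W 0 = γ⁻¹ →
        (∀ᶠ s in 𝓝 0, F (W s) = s ^ 2) → W =ᶠ[𝓝 0] U := by
  have hF' : AnalyticAt ℂ (fun v => F (u₀ + v)) 0 := by
    refine AnalyticAt.fun_comp (g := F) ?_ (by fun_prop)
    simpa using hF
  obtain ⟨R, hR, hFR⟩ := hF'.exists_eq_sum_add_pow_mul 3
  set H : ℂ → ℂ := fun u => 1 + (u - u₀) * R (u - u₀) / γ ^ 2 with hH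
  have hFH : ∀ u, F u = (γ * (u - u₀)) ^ 2 * H u := by
    intro u
    have h := hFR (u - u₀)
    simp only [Finset.sum_range_succ, Finset.sum_range_zero, iteratedDeriv_comp_const_add,
      iteratedDeriv_zero, iteratedDeriv_one, add_zero, h0, h1, h2, smul_eq_mul,
      add_sub_cancel] at h
    rw [h, hH]
    simp [Nat.factorial]
    field_simp
  have hRan : AnalyticAt ℂ (fun u => R (u - u₀)) u₀ := by
    refine AnalyticAt.fun_comp (g := R) ?_ (by fun_prop)
    simpa using hR
  have hHan : AnalyticAt ℂ H u₀ := by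
    have h3 : AnalyticAt ℂ (fun u => u - u₀) u₀ := by fun_prop
    exact analyticAt_const.add ((h3.mul hRan).mul analyticAt_const)
  have hH0 : H u₀ = 1 := by simp [hH]
  set S : ℂ → ℂ := fun u => γ * (u - u₀) * H u ^ (2⁻¹ : ℂ) with hS
  have hK : AnalyticAt ℂ (fun u => H u ^ (2⁻¹ : ℂ)) u₀ :=
    hHan.cpow analyticAt_const (by rw [hH0]; exact Complex.one_mem_slitPlane)
  have hSan : AnalyticAt ℂ S u₀ := by
    simp only [hS]
    fun_prop
  have hSF : ∀ u, S u ^ 2 = F u := by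
    intro u
    rw [hFH, hS, mul_pow, Complex.cpow_ofNat_inv_pow]
  have hS0 : S u₀ = 0 := by simp [hS]
  have hSd : deriv S u₀ = γ := by
    have h3 : HasDerivAt (fun u => γ * (u - u₀)) (γ * 1) u₀ :=
      ((hasDerivAt_id u₀).sub_const u₀).const_mul γ
    have := (h3.mul hK.differentiableAt.hasDerivAt).deriv
    refine Eq.trans this ?_
    simp [hH0]
  have hSd0 : deriv S u₀ ≠ 0 := by rwa [hSd]
  set U := hSan.hasStrictDerivAt.localInverse S (deriv S u₀) u₀ hSd0 with hU
  have hUan : AnalyticAt ℂ U 0 := hS0 ▸ hSan.analyticAt_localInverse hSd0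
  have hU0 : U 0 = u₀ := by
    have : U (S u₀) = u₀ := HasStrictFDerivAt.localInverse_apply_image ..
    rwa [hS0] at this
  have hUd : deriv U 0 = γ⁻¹ := by
    have := (hSan.hasStrictDerivAt.to_localInverse hSd0).hasDerivAt.deriv
    rw [hS0] at this
    exact this.trans (congrArg _ hSd)
  have hright : ∀ᶠ s in 𝓝 0, S (U s) = s := by
    have := hSan.hasStrictDerivAt.eventually_right_inverse hSd0
    rwa [hS0] at this
  have hleft : ∀ᶠ u in 𝓝 u₀, U (S u) = u :=
    hSan.hasStrictDerivAt.eventually_left_inverse hSd0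
  refine ⟨U, ⟨hUan, hU0, hUd, ?_⟩, fun W hW hW0 hWd hWF => ?_⟩
  · filter_upwards [hright] with s hs
    rw [← hSF, hs]
  · have hSW : AnalyticAt ℂ (fun s => S (W s)) 0 :=
      AnalyticAt.fun_comp (g := S) (by rw [hW0]; exact hSan) hW
    -- `S ∘ W` is `s` or `-s`; the sum `S ∘ W + s` has a simple zero, so it is not `-s`
    have hsum : AnalyticAt ℂ (fun s => S (W s) + s) 0 := hSW.add analyticAt_id
    have hsumd : deriv (fun s => S (W s) + s) 0 = 2 := by
      have h3 : HasDerivAt (fun s => S (W s)) (γ * γ⁻¹) 0 := by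
        have h4 : HasDerivAt S γ (W 0) := by
          rw [hW0, ← hSd]; exact hSan.differentiableAt.hasDerivAt
        have h5 : HasDerivAt W γ⁻¹ 0 := by rw [← hWd]; exact hW.differentiableAt.hasDerivAt
        exact h4.comp 0 h5
      have := (h3.add (hasDerivAt_id (0 : ℂ))).deriv
      refine Eq.trans this ?_
      rw [mul_inv_cancel₀ hγ]
      norm_num
    have hne : ∀ᶠ s in 𝓝[≠] (0 : ℂ), S (W s) + s ≠ 0 := by
      rcases hsum.eventually_eq_zero_or_eventually_ne_zero with h | h
      · have h' : (fun s => S (W s) + s) =ᶠ[𝓝 0] fun _ => 0 := h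
        rw [h'.deriv_eq, deriv_const] at hsumd
        exact absurd hsumd.symm two_ne_zero
      · exact h
    have heq : ∀ᶠ s in 𝓝 (0 : ℂ), S (W s) = s := by
      have h3 : ∀ᶠ s in 𝓝[≠] (0 : ℂ), S (W s) = s := by
        filter_upwards [hne, hWF.filter_mono nhdsWithin_le_nhds] with s h4 h5
        rw [← hSF] at h5
        have : (S (W s) + s) * (S (W s) - s) = 0 := by linear_combination h5
        exact sub_eq_zero.mp ((mul_eq_zero.mp this).resolve_left h4)
      rw [eventually_nhdsWithin_iff] at h3
      filter_upwards [h3] with s hs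
      by_cases h : s = 0
      · rw [h, hW0, hS0]
      · exact hs h
    have hWt : Tendsto W (𝓝 0) (𝓝 u₀) := hW0 ▸ hW.continuousAt.tendsto
    filter_upwards [heq, hWt.eventually hleft] with s h3 h4
    rw [← h4, h3]

/-! ### The saddle point -/

/-- The complex phase `tan u - a u`, normalised to vanish at the saddle point. -/
noncomputable def saddlePhase (a : ℝ) (u : ℂ) : ℂ :=
  Complex.tan u - a * u - (Complex.tan (saddle a) - a * saddle a)

/-- The real number `√(a √(a - 1))`, a square root of half the second derivative of the phase at
the saddle point. -/
noncomputable def saddleScale (a : ℝ) : ℝ := Real.sqrt (a * Real.sqrt (a - 1))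

theorem saddleScale_pos {a : ℝ} (ha : 1 < a) : 0 < saddleScale a :=
  Real.sqrt_pos.mpr (mul_pos (by linarith) (Real.sqrt_pos.mpr (by linarith)))

theorem saddleScale_sq {a : ℝ} (ha : 1 < a) : saddleScale a ^ 2 = a * Real.sqrt (a - 1) :=
  Real.sq_sqrt (mul_nonneg (by linarith) (Real.sqrt_nonneg _))

theorem cos_saddle_ne_zero (a : ℝ) : Complex.cos (saddle a) ≠ 0 := by
  rw [← Complex.ofReal_cos]
  exact_mod_cast cos_ne_zero_of_mem_Ioo (saddle_mem a)

theorem cos_saddle_sq {a : ℝ} (ha : 1 < a) : Complex.cos (saddle a) ^ 2 = 1 / a := by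
  rw [← Complex.ofReal_cos, saddle, ← Complex.ofReal_pow, Real.cos_sq_arctan,
    Real.sq_sqrt (by linarith)]
  push_cast
  ring

theorem hasDerivAt_saddlePhase (a : ℝ) {u : ℂ} (hu : Complex.cos u ≠ 0) :
    HasDerivAt (saddlePhase a) (1 / Complex.cos u ^ 2 - a) u :=
  (((Complex.hasDerivAt_tan hu).sub ((hasDerivAt_id u).const_mul (a : ℂ))).sub_const _
    ).congr_deriv (by simp)

theorem eventually_cos_ne_zero (a : ℝ) : ∀ᶠ u in 𝓝 (saddle a : ℂ), Complex.cos u ≠ 0 :=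
  Complex.continuous_cos.continuousAt.eventually_ne (cos_saddle_ne_zero a)

theorem analyticAt_saddlePhase (a : ℝ) : AnalyticAt ℂ (saddlePhase a) (saddle a) := by
  rw [Complex.analyticAt_iff_eventually_differentiableAt]
  filter_upwards [eventually_cos_ne_zero a] with u hu
  exact (hasDerivAt_saddlePhase a hu).differentiableAt

theorem saddlePhase_saddle (a : ℝ) : saddlePhase a (saddle a) = 0 := by simp [saddlePhase]

theorem deriv_saddlePhase_saddle {a : ℝ} (ha : 1 < a) : deriv (saddlePhase a) (saddle a) = 0 := by
  rw [(hasDerivAt_saddlePhase a (cos_saddle_ne_zero a)).deriv, cos_saddle_sq ha]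
  simp

theorem iteratedDeriv_two_saddlePhase {a : ℝ} (ha : 1 < a) :
    iteratedDeriv 2 (saddlePhase a) (saddle a) = 2 * (saddleScale a : ℂ) ^ 2 := by
  have h1 : deriv (saddlePhase a) =ᶠ[𝓝 (saddle a : ℂ)] fun u => 1 / Complex.cos u ^ 2 - a := by
    filter_upwards [eventually_cos_ne_zero a] with u hu
    exact (hasDerivAt_saddlePhase a hu).deriv
  have hc := cos_saddle_ne_zero a
  have ha0 : (a : ℂ) ≠ 0 := by exact_mod_cast (by linarith : a ≠ 0)
  have h2 : HasDerivAt (fun u : ℂ => 1 / Complex.cos u ^ 2 - a)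
      (2 * Complex.tan (saddle a) * (1 / Complex.cos (saddle a) ^ 2)) (saddle a) := by
    have h3 := ((Complex.hasDerivAt_cos (saddle a : ℂ)).pow 2)
    refine (((hasDerivAt_const (saddle a : ℂ) (1 : ℂ)).div h3 (pow_ne_zero 2 hc)).sub_const _
      ).congr_deriv ?_
    simp only [Complex.tan]
    field_simp
    simp
    ring
  rw [iteratedDeriv_succ, iteratedDeriv_one, h1.deriv_eq, h2.deriv, cos_saddle_sq ha,
    ← Complex.ofReal_tan, tan_saddle, ← Complex.ofReal_pow, saddleScale_sq ha]
  push_cast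
  field_simp

theorem exists_unique_saddle_coordinate {a : ℝ} (ha : 1 < a) :
    ∃ U : ℂ → ℂ, (AnalyticAt ℂ U 0 ∧ U 0 = saddle a ∧ deriv U 0 = (saddleScale a : ℂ)⁻¹ ∧
        ∀ᶠ s in 𝓝 0, saddlePhase a (U s) = s ^ 2) ∧
      ∀ W : ℂ → ℂ, AnalyticAt ℂ W 0 → W 0 = saddle a → deriv W 0 = (saddleScale a : ℂ)⁻¹ →
        (∀ᶠ s in 𝓝 0, saddlePhase a (W s) = s ^ 2) → W =ᶠ[𝓝 0] U :=
  exists_unique_quadratic_coordinate (analyticAt_saddlePhase a) (saddlePhase_saddle a)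
    (deriv_saddlePhase_saddle ha) (by exact_mod_cast (saddleScale_pos ha).ne')
    (iteratedDeriv_two_saddlePhase ha)

/-- The coordinate `s ↦ u` at the saddle point: the analytic germ with `tan u - a u = s²` up to
the critical value, and with positive derivative at `s = 0`. It is `0` unless `1 < a`. -/
noncomputable def saddleCoord (a : ℝ) : ℂ → ℂ :=
  open Classical in
  if ha : 1 < a then (exists_unique_saddle_coordinate ha).choose else 0

theorem saddleCoord_spec {a : ℝ} (ha : 1 < a) :
    (AnalyticAt ℂ (saddleCoord a) 0 ∧ saddleCoord a 0 = saddle a ∧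
        deriv (saddleCoord a) 0 = (saddleScale a : ℂ)⁻¹ ∧
        ∀ᶠ s in 𝓝 0, saddlePhase a (saddleCoord a s) = s ^ 2) ∧
      ∀ W : ℂ → ℂ, AnalyticAt ℂ W 0 → W 0 = saddle a → deriv W 0 = (saddleScale a : ℂ)⁻¹ →
        (∀ᶠ s in 𝓝 0, saddlePhase a (W s) = s ^ 2) → W =ᶠ[𝓝 0] saddleCoord a := by
  rw [saddleCoord, dif_pos ha]
  exact (exists_unique_saddle_coordinate ha).choose_spec

open ComplexConjugate in
theorem saddlePhase_conj (a : ℝ) (u : ℂ) : saddlePhase a (conj u) = conj (saddlePhase a u) := by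
  simp only [saddlePhase, map_sub, map_mul, ← Complex.tan_conj, Complex.conj_ofReal]

open ComplexConjugate in
/-- The coordinate commutes with conjugation, by its uniqueness. -/
theorem saddleCoord_conj {a : ℝ} (ha : 1 < a) :
    (conj ∘ saddleCoord a ∘ conj) =ᶠ[𝓝 0] saddleCoord a := by
  obtain ⟨⟨h1, h2, h3, h4⟩, huniq⟩ := saddleCoord_spec ha
  have hconj : Tendsto (conj : ℂ → ℂ) (𝓝 0) (𝓝 0) := by
    have := Complex.continuous_conj.tendsto (0 : ℂ)
    rwa [map_zero] at this
  refine huniq _ ?_ ?_ ?_ ?_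
  · rw [Complex.analyticAt_iff_eventually_differentiableAt] at h1 ⊢
    filter_upwards [hconj.eventually h1] with z hz
    simpa using hz.conj_conj
  · simp [h2]
  · rw [deriv_conj_conj]
    simp [h3]
  · filter_upwards [hconj.eventually h4] with z hz
    simp only [Function.comp_apply]
    rw [saddlePhase_conj, hz, map_pow, Complex.conj_conj]

/-! ### Taylor coefficients -/

/-- The `n`-th Maclaurin coefficient of `f`. -/
noncomputable def maclaurin (f : ℂ → ℂ) (n : ℕ) : ℂ := iteratedDeriv n f 0 / (n.factorial : ℂ)

theorem maclaurin_zero (f : ℂ → ℂ) : maclaurin f 0 = f 0 := by simp [maclaurin]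

theorem maclaurin_congr {f g : ℂ → ℂ} (h : f =ᶠ[𝓝 0] g) (n : ℕ) :
    maclaurin f n = maclaurin g n := by
  rw [maclaurin, maclaurin, h.iteratedDeriv_eq]

theorem maclaurin_deriv (f : ℂ → ℂ) (n : ℕ) :
    maclaurin (deriv f) n = (n + 1) * maclaurin f (n + 1) := by
  have h : (n.factorial : ℂ) ≠ 0 := by exact_mod_cast n.factorial_ne_zero
  have h' : (n + 1 : ℂ) ≠ 0 := by exact_mod_cast n.succ_ne_zero
  rw [maclaurin, maclaurin, iteratedDeriv_succ', Nat.factorial_succ]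
  push_cast
  field_simp

theorem maclaurin_add {f g : ℂ → ℂ} (hf : AnalyticAt ℂ f 0) (hg : AnalyticAt ℂ g 0) (n : ℕ) :
    maclaurin (fun s => f s + g s) n = maclaurin f n + maclaurin g n := by
  rw [maclaurin, iteratedDeriv_fun_add hf.contDiffAt hg.contDiffAt, add_div]; rfl

theorem maclaurin_const_mul (c : ℂ) (f : ℂ → ℂ) (n : ℕ) :
    maclaurin (fun s => c * f s) n = c * maclaurin f n := by
  rw [maclaurin, iteratedDeriv_const_mul_field, mul_div_assoc]; rfl

theorem maclaurin_const (c : ℂ) (n : ℕ) :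
    maclaurin (fun _ => c) n = if n = 0 then c else 0 := by
  by_cases h : n = 0
  · simp [h, maclaurin]
  · simp [h, maclaurin, iteratedDeriv_const]

theorem maclaurin_id (n : ℕ) : maclaurin (fun s => s) n = if n = 1 then 1 else 0 := by
  rw [maclaurin, iteratedDeriv_fun_id_zero]
  by_cases h : n = 1 <;> simp [h]

theorem maclaurin_mul {f g : ℂ → ℂ} (hf : AnalyticAt ℂ f 0) (hg : AnalyticAt ℂ g 0) (n : ℕ) :
    maclaurin (fun s => f s * g s) n =
      ∑ i ∈ Finset.range (n + 1), maclaurin f i * maclaurin g (n - i) := by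
  rw [maclaurin, iteratedDeriv_fun_mul hf.contDiffAt hg.contDiffAt, Finset.sum_div]
  refine Finset.sum_congr rfl fun i hi => ?_
  have hi' : i ≤ n := Nat.lt_succ_iff.mp (Finset.mem_range.mp hi)
  have h1 : (i.factorial : ℂ) ≠ 0 := by exact_mod_cast i.factorial_ne_zero
  have h2 : ((n - i).factorial : ℂ) ≠ 0 := by exact_mod_cast (n - i).factorial_ne_zero
  have h3 : (n.factorial : ℂ) ≠ 0 := by exact_mod_cast n.factorial_ne_zero
  rw [maclaurin, maclaurin, Nat.cast_choose ℂ hi']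
  field_simp

theorem maclaurin_id_mul_succ {f : ℂ → ℂ} (hf : AnalyticAt ℂ f 0) (n : ℕ) :
    maclaurin (fun s => s * f s) (n + 1) = maclaurin f n := by
  have hid : AnalyticAt ℂ (fun s : ℂ => s) 0 := analyticAt_id
  rw [maclaurin_mul hid hf, Finset.sum_eq_single 1]
  · simp [maclaurin_id]
  · intro i _ hi
    simp [maclaurin_id, hi]
  · intro h
    exact absurd (Finset.mem_range.mpr (by omega)) h

theorem maclaurin_comp_mul (f : ℂ → ℂ) (κ : ℂ) (n : ℕ) :
    maclaurin (fun w => f (κ * w)) n = κ ^ n * maclaurin f n := by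
  have h : ∀ n, iteratedDeriv n (fun w => f (κ * w)) =
      fun w => κ ^ n * iteratedDeriv n f (κ * w) := by
    intro n
    induction n with
    | zero => simp
    | succ n ih =>
      funext w
      rw [iteratedDeriv_succ, ih, deriv_const_mul_field', iteratedDeriv_succ]
      simp only [deriv_comp_mul_left, smul_eq_mul, pow_succ]
      ring
  rw [maclaurin, h]
  simp only [mul_zero, mul_div_assoc]
  rfl

open ComplexConjugate in
theorem iteratedDeriv_conj_conj (f : ℂ → ℂ) (n : ℕ) :
    iteratedDeriv n (conj ∘ f ∘ conj) = conj ∘ iteratedDeriv n f ∘ conj := by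
  induction n with
  | zero => simp
  | succ n ih =>
    funext z
    rw [iteratedDeriv_succ, ih, iteratedDeriv_succ]
    simp [deriv_conj_conj]

open ComplexConjugate in
theorem conj_maclaurin_of_conj_conj {f : ℂ → ℂ} (h : (conj ∘ f ∘ conj) =ᶠ[𝓝 0] f) (n : ℕ) :
    conj (maclaurin f n) = maclaurin f n := by
  rw [maclaurin, map_div₀]
  nth_rewrite 1 [← h.iteratedDeriv_eq]
  rw [iteratedDeriv_conj_conj]
  simp

/-! ### The saddle point coefficients -/

/-- The coefficient `A_{2k}(a)`. The Maclaurin coefficients of the coordinate are real, so taking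
the real part loses nothing. -/
noncomputable def saddleCoeff (a : ℝ) (k : ℕ) : ℝ :=
  saddleScale a * (maclaurin (deriv (saddleCoord a)) (2 * k)).re

theorem ofReal_saddleCoeff {a : ℝ} (ha : 1 < a) (k : ℕ) :
    (saddleCoeff a k : ℂ) = saddleScale a * maclaurin (deriv (saddleCoord a)) (2 * k) := by
  have h := conj_maclaurin_of_conj_conj (saddleCoord_conj ha) (2 * k + 1)
  rw [Complex.conj_eq_iff_re] at h
  rw [saddleCoeff, maclaurin_deriv, ← h]
  push_cast
  have : ((2 : ℂ) * k + 1) = ((2 * k + 1 : ℝ) : ℂ) := by push_cast; rfl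
  rw [this, Complex.re_ofReal_mul, Complex.ofReal_mul, Complex.ofReal_re]

theorem maclaurin_deriv_saddleCoord {a : ℝ} (ha : 1 < a) (k : ℕ) :
    maclaurin (deriv (saddleCoord a)) (2 * k) = (saddleScale a : ℂ)⁻¹ * saddleCoeff a k := by
  have : (saddleScale a : ℂ) ≠ 0 := by exact_mod_cast (saddleScale_pos ha).ne'
  rw [ofReal_saddleCoeff ha]
  field_simp

/-- `√i`, obtained from the constant of the inversion in the variable `w`: the two coordinates
are related by `s = √i w`. -/
noncomputable def sqrtI (a : ℝ) : ℂ := inversionConst a * saddleScale a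

theorem sqrtI_sq {a : ℝ} (ha : 1 < a) : sqrtI a ^ 2 = Complex.I := by
  have ha0 : (a : ℂ) ≠ 0 := by exact_mod_cast (by linarith : a ≠ 0)
  have h1 : ((a - 1) ^ (-1 / 4 : ℝ)) ^ 2 * Real.sqrt (a - 1) = 1 := by
    have hpos : 0 < a - 1 := by linarith
    rw [Real.sqrt_eq_rpow, ← Real.rpow_natCast, ← Real.rpow_mul hpos.le, ← Real.rpow_add hpos]
    norm_num
  have h1' : ((((a - 1) ^ (-1 / 4 : ℝ) : ℝ) : ℂ)) ^ 2 * (Real.sqrt (a - 1) : ℂ) = 1 := by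
    exact_mod_cast h1
  have h2 : ((Complex.I / a) ^ (1 / 2 : ℂ)) ^ 2 = Complex.I / a := by
    rw [one_div, Complex.cpow_ofNat_inv_pow]
  have h3 : (saddleScale a : ℂ) ^ 2 = a * (Real.sqrt (a - 1) : ℂ) := by
    exact_mod_cast saddleScale_sq ha
  rw [sqrtI, mul_pow, inversionConst, mul_pow, h2, h3]
  calc _ = Complex.I / a * a * ((((a - 1) ^ (-1 / 4 : ℝ) : ℝ) : ℂ) ^ 2 *
        (Real.sqrt (a - 1) : ℂ)) := by ring
    _ = Complex.I := by rw [h1', mul_one, div_mul_cancel₀ _ ha0]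

theorem psi_sub_psi_saddle (a : ℝ) (u : ℂ) :
    psi a u - psi a (saddle a) = Complex.I * saddlePhase a u := by
  simp only [psi, saddlePhase]
  ring

theorem isSaddleInversion_saddleCoord {a : ℝ} (ha : 1 < a) :
    IsSaddleInversion a fun w => saddleCoord a (sqrtI a * w) := by
  obtain ⟨⟨h1, h2, h3, h4⟩, -⟩ := saddleCoord_spec ha
  have hγ : (saddleScale a : ℂ) ≠ 0 := by exact_mod_cast (saddleScale_pos ha).ne'
  refine ⟨?_, ?_, ?_, ?_⟩
  · exact AnalyticAt.fun_comp (g := saddleCoord a) (by simpa using h1) (by fun_prop)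
  · simpa using h2
  · rw [deriv_comp_mul_left, mul_zero, h3, smul_eq_mul, sqrtI]
    field_simp
  · have ht : Tendsto (fun w : ℂ => sqrtI a * w) (𝓝 0) (𝓝 0) := by
      have : Continuous fun w : ℂ => sqrtI a * w := by fun_prop
      simpa using this.tendsto 0
    filter_upwards [ht.eventually h4] with w hw
    rw [psi_sub_psi_saddle, hw, mul_pow, sqrtI_sq ha, ← mul_assoc, Complex.I_mul_I]
    ring

theorem IsSaddleInversion.eventuallyEq {a : ℝ} (ha : 1 < a) {u : ℂ → ℂ}
    (hu : IsSaddleInversion a u) : u =ᶠ[𝓝 0] fun w => saddleCoord a (sqrtI a * w) := by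
  obtain ⟨-, huniq⟩ := saddleCoord_spec ha
  have hκ : sqrtI a ≠ 0 := by
    intro h
    have := sqrtI_sq ha
    rw [h] at this
    simp at this
    exact Complex.I_ne_zero this.symm
  have hγ : (saddleScale a : ℂ) ≠ 0 := by exact_mod_cast (saddleScale_pos ha).ne'
  have ht : ∀ c : ℂ, Tendsto (fun w : ℂ => c * w) (𝓝 0) (𝓝 0) := by
    intro c
    have : Continuous fun w : ℂ => c * w := by fun_prop
    simpa using this.tendsto 0
  have key : (fun s => u ((sqrtI a)⁻¹ * s)) =ᶠ[𝓝 0] saddleCoord a := by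
    refine huniq _ ?_ ?_ ?_ ?_
    · exact AnalyticAt.fun_comp (g := u) (by simpa using hu.analyticAt) (by fun_prop)
    · simpa using hu.map_zero
    · rw [deriv_comp_mul_left, mul_zero, hu.deriv_zero, smul_eq_mul]
      have hc : inversionConst a ≠ 0 := left_ne_zero_of_mul hκ
      rw [sqrtI]
      field_simp
    · filter_upwards [(ht (sqrtI a)⁻¹).eventually hu.phase_eq] with s hs
      rw [psi_sub_psi_saddle, mul_pow, inv_pow, sqrtI_sq ha] at hs
      rw [Complex.inv_I] at hs
      have := congrArg (fun z => -Complex.I * z) hs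
      simp only [← mul_assoc, neg_mul, Complex.I_mul_I, neg_neg, one_mul] at this
      exact this
  filter_upwards [(ht (sqrtI a)).eventually key] with w hw
  rw [← hw, inv_mul_cancel_left₀ hκ]

theorem IsSaddleInversion.maclaurin_deriv {a : ℝ} (ha : 1 < a) {u : ℂ → ℂ}
    (hu : IsSaddleInversion a u) (k : ℕ) :
    iteratedDeriv (2 * k) (deriv u) 0 / ((2 * k).factorial : ℂ) =
      inversionConst a * (Complex.I ^ k * (saddleCoeff a k : ℂ)) := by
  have h1 : deriv u =ᶠ[𝓝 0] fun w => sqrtI a * deriv (saddleCoord a) (sqrtI a * w) := by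
    have h2 := (hu.eventuallyEq ha).deriv
    filter_upwards [h2] with w hw
    rw [hw, deriv_comp_mul_left, smul_eq_mul]
  have hγ : (saddleScale a : ℂ) ≠ 0 := by exact_mod_cast (saddleScale_pos ha).ne'
  change maclaurin (deriv u) (2 * k) = _
  rw [maclaurin_congr h1, maclaurin_const_mul, maclaurin_comp_mul, pow_mul, sqrtI_sq ha,
    maclaurin_deriv_saddleCoord ha, sqrtI]
  field_simp

theorem isSaddleCoeffs_saddleCoeff {a : ℝ} (ha : 1 < a) : IsSaddleCoeffs a (saddleCoeff a) :=
  ⟨_, isSaddleInversion_saddleCoord ha, (isSaddleInversion_saddleCoord ha).maclaurin_deriv ha⟩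

theorem IsSaddleCoeffs.eq_saddleCoeff {a : ℝ} (ha : 1 < a) {B : ℕ → ℝ}
    (hB : IsSaddleCoeffs a B) : B = saddleCoeff a := by
  obtain ⟨u, hu, huB⟩ := hB
  funext k
  have h := (huB k).symm.trans (hu.maclaurin_deriv ha k)
  have hc : inversionConst a ≠ 0 := by
    intro h0
    have := sqrtI_sq ha
    rw [sqrtI, h0] at this
    simp at this
    exact Complex.I_ne_zero this.symm
  have := mul_left_cancel₀ (pow_ne_zero k Complex.I_ne_zero) (mul_left_cancel₀ hc h)
  exact_mod_cast this

/-! ### The first coefficients -/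

/-- The solution, up to order nine, of the recursion for the coefficients `σ` of `tan u - √(a - 1)`
and `R` of `tan² u - (a - 1)`, both scaled to be polynomials in `a`. In the relation of index `n`
the unknown `σ (n + 2)` appears through `R 1 * (n + 2) * σ (n + 2)` and through
`R (n + 2) * σ 1`, in all with the factor `2 * (n + 3)`. -/
theorem scaled_coeff_values {K : Type*} [Field K] [CharZero K] {a : K} {σ R : ℕ → K}
    (hσ0 : σ 0 = 0) (hσ1 : σ 1 = 1)
    (hR : ∀ n, R n = 2 * σ n + a * ∑ i ∈ Finset.range (n + 1), σ i * σ (n - i))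
    (hrec : ∀ n, ∑ i ∈ Finset.range (n + 3), R i * (((n + 2 - i : ℕ) + 1 : K) * σ (n + 2 - i + 1)) =
      2 * (a - 1) * R (n + 1)) :
    σ 3 = (8 - 12 * a + 9 * a ^ 2) / 72 ∧
    σ 5 = (64 - 192 * a + 288 * a ^ 2 + 360 * a ^ 3 - 135 * a ^ 4) / 17280 ∧
    σ 7 = (-71168 + 320256 * a - 554688 * a ^ 2 + 518400 * a ^ 3 + 340200 * a ^ 4
      - 170100 * a ^ 5 + 42525 * a ^ 6) / 43545600 ∧
    σ 9 = (-2338816 + 14032896 * a - 36790272 * a ^ 2 + 55710720 * a ^ 3 - 32876928 * a ^ 4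
      + 231880320 * a ^ 5 - 68584320 * a ^ 6 + 30618000 * a ^ 7 - 5740875 * a ^ 8) /
        37623398400 := by
  have r0 : R 0 = 0 := by rw [hR]; simp [hσ0]
  have r1 : R 1 = 2 := by rw [hR]; simp [hσ0, hσ1, Finset.sum_range_succ]
  have s2 : σ 2 = (-4 + 3 * a) / 6 := by
    have e := hrec 0
    have q := hR 2
    simp only [Finset.sum_range_succ, Finset.sum_range_zero, hσ0, hσ1, r0, r1, zero_mul, mul_zero,
      zero_add, add_zero, Nat.reduceAdd, Nat.reduceSub, Nat.cast_ofNat, Nat.cast_zero,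
      Nat.cast_one, mul_one, Nat.sub_zero, Nat.sub_self] at e q
    linear_combination (e - q) / 6
  have r2 : R 2 = (-4 + 6 * a) / 3 := by
    have q := hR 2
    simp only [Finset.sum_range_succ, Finset.sum_range_zero, hσ0, hσ1, zero_mul, mul_zero,
      zero_add, add_zero, Nat.reduceAdd, Nat.reduceSub, mul_one, Nat.sub_zero, Nat.sub_self,
      s2] at q
    rw [q]
    ring
  have s3 : σ 3 = (8 - 12 * a + 9 * a ^ 2) / 72 := by
    have e := hrec 1
    have q := hR 3
    simp only [Finset.sum_range_succ, Finset.sum_range_zero, hσ0, hσ1, r0, r1, zero_mul, mul_zero,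
      zero_add, add_zero, Nat.reduceAdd, Nat.reduceSub, Nat.cast_ofNat, Nat.cast_zero,
      Nat.cast_one, mul_one, one_mul, Nat.sub_zero, Nat.sub_self,
      s2, r2] at e q
    linear_combination (e - q) / 8
  have r3 : R 3 = (8 - 60 * a + 45 * a ^ 2) / 36 := by
    have q := hR 3
    simp only [Finset.sum_range_succ, Finset.sum_range_zero, hσ0, hσ1, zero_mul, mul_zero,
      zero_add, add_zero, Nat.reduceAdd, Nat.reduceSub, mul_one, one_mul, Nat.sub_zero,
      Nat.sub_self, s2, s3] at q
    rw [q]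
    ring
  have s4 : σ 4 = (4 - 9 * a) / 135 := by
    have e := hrec 2
    have q := hR 4
    simp only [Finset.sum_range_succ, Finset.sum_range_zero, hσ0, hσ1, r0, r1, zero_mul, mul_zero,
      zero_add, add_zero, Nat.reduceAdd, Nat.reduceSub, Nat.cast_ofNat, Nat.cast_zero,
      Nat.cast_one, mul_one, one_mul, Nat.sub_zero, Nat.sub_self,
      s2, r2, s3, r3] at e q
    linear_combination (e - q) / 10
  have r4 : R 4 = (16 + 144 * a - 270 * a ^ 2 + 135 * a ^ 3) / 270 := by
    have q := hR 4
    simp only [Finset.sum_range_succ, Finset.sum_range_zero, hσ0, hσ1, zero_mul, mul_zero,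
      zero_add, add_zero, Nat.reduceAdd, Nat.reduceSub, mul_one, one_mul, Nat.sub_zero,
      Nat.sub_self, s2, s3, s4] at q
    rw [q]
    ring
  have s5 : σ 5 = (64 - 192 * a + 288 * a ^ 2 + 360 * a ^ 3 - 135 * a ^ 4) / 17280 := by
    have e := hrec 3
    have q := hR 5
    simp only [Finset.sum_range_succ, Finset.sum_range_zero, hσ0, hσ1, r0, r1, zero_mul, mul_zero,
      zero_add, add_zero, Nat.reduceAdd, Nat.reduceSub, Nat.cast_ofNat, Nat.cast_zero,
      Nat.cast_one, mul_one, one_mul, Nat.sub_zero, Nat.sub_self,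
      s2, r2, s3, r3, s4, r4] at e q
    linear_combination (e - q) / 12
  have r5 : R 5 = (64 - 960 * a + 2016 * a ^ 2 - 2520 * a ^ 3 + 945 * a ^ 4) / 8640 := by
    have q := hR 5
    simp only [Finset.sum_range_succ, Finset.sum_range_zero, hσ0, hσ1, zero_mul, mul_zero,
      zero_add, add_zero, Nat.reduceAdd, Nat.reduceSub, mul_one, one_mul, Nat.sub_zero,
      Nat.sub_self, s2, s3, s4, s5] at q
    rw [q]
    ring
  have s6 : σ 6 = (-32 + 120 * a - 144 * a ^ 2 - 189 * a ^ 3) / 17010 := by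
    have e := hrec 4
    have q := hR 6
    simp only [Finset.sum_range_succ, Finset.sum_range_zero, hσ0, hσ1, r0, r1, zero_mul, mul_zero,
      zero_add, add_zero, Nat.reduceAdd, Nat.reduceSub, Nat.cast_ofNat, Nat.cast_zero,
      Nat.cast_one, mul_one, one_mul, Nat.sub_zero, Nat.sub_self,
      s2, r2, s3, r3, s4, r4, s5, r5] at e q
    linear_combination (e - q) / 14
  have r6 : R 6 = (-32 - 48 * a + 360 * a ^ 2) / 8505 := by
    have q := hR 6
    simp only [Finset.sum_range_succ, Finset.sum_range_zero, hσ0, hσ1, zero_mul, mul_zero,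
      zero_add, add_zero, Nat.reduceAdd, Nat.reduceSub, mul_one, one_mul, Nat.sub_zero,
      Nat.sub_self, s2, s3, s4, s5, s6] at q
    rw [q]
    ring
  have s7 : σ 7 = (-71168 + 320256 * a - 554688 * a ^ 2 + 518400 * a ^ 3 + 340200 * a ^ 4
      - 170100 * a ^ 5 + 42525 * a ^ 6) / 43545600 := by
    have e := hrec 5
    have q := hR 7
    simp only [Finset.sum_range_succ, Finset.sum_range_zero, hσ0, hσ1, r0, r1, zero_mul, mul_zero,
      zero_add, add_zero, Nat.reduceAdd, Nat.reduceSub, Nat.cast_ofNat, Nat.cast_zero,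
      Nat.cast_one, mul_one, one_mul, Nat.sub_zero, Nat.sub_self,
      s2, r2, s3, r3, s4, r4, s5, r5, s6, r6] at e q
    linear_combination (e - q) / 16
  have r7 : R 7 = (-71168 + 274176 * a - 381888 * a ^ 2 + 69120 * a ^ 3 - 748440 * a ^ 4
      + 510300 * a ^ 5 - 127575 * a ^ 6) / 21772800 := by
    have q := hR 7
    simp only [Finset.sum_range_succ, Finset.sum_range_zero, hσ0, hσ1, zero_mul, mul_zero,
      zero_add, add_zero, Nat.reduceAdd, Nat.reduceSub, mul_one, one_mul, Nat.sub_zero,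
      Nat.sub_self, s2, s3, s4, s5, s6, s7] at q
    rw [q]
    ring
  have s8 : σ 8 = (-16 + 84 * a - 180 * a ^ 2 + 207 * a ^ 3 - 270 * a ^ 4) / 25515 := by
    have e := hrec 6
    have q := hR 8
    simp only [Finset.sum_range_succ, Finset.sum_range_zero, hσ0, hσ1, r0, r1, zero_mul, mul_zero,
      zero_add, add_zero, Nat.reduceAdd, Nat.reduceSub, Nat.cast_ofNat, Nat.cast_zero,
      Nat.cast_one, mul_one, one_mul, Nat.sub_zero, Nat.sub_self,
      s2, r2, s3, r3, s4, r4, s5, r5, s6, r6, s7, r7] at e q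
    linear_combination (e - q) / 18
  have r8 : R 8 = (-32 + 192 * a - 468 * a ^ 2 + 558 * a ^ 3 + 135 * a ^ 4) / 25515 := by
    have q := hR 8
    simp only [Finset.sum_range_succ, Finset.sum_range_zero, hσ0, hσ1, zero_mul, mul_zero,
      zero_add, add_zero, Nat.reduceAdd, Nat.reduceSub, mul_one, one_mul, Nat.sub_zero,
      Nat.sub_self, s2, s3, s4, s5, s6, s7, s8] at q
    rw [q]
    ring
  have s9 : σ 9 = (-2338816 + 14032896 * a - 36790272 * a ^ 2 + 55710720 * a ^ 3 - 32876928 * a ^ 4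
      + 231880320 * a ^ 5 - 68584320 * a ^ 6 + 30618000 * a ^ 7 - 5740875 * a ^ 8) /
        37623398400 := by
    have e := hrec 7
    have q := hR 9
    simp only [Finset.sum_range_succ, Finset.sum_range_zero, hσ0, hσ1, r0, r1, zero_mul, mul_zero,
      zero_add, add_zero, Nat.reduceAdd, Nat.reduceSub, Nat.cast_ofNat, Nat.cast_zero,
      Nat.cast_one, mul_one, one_mul, Nat.sub_zero, Nat.sub_self,
      s2, r2, s3, r3, s4, r4, s5, r5, s6, r6, s7, r7, s8, r8] at e q
    linear_combination (e - q) / 20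
  exact ⟨s3, s5, s7, s9⟩

theorem eventually_saddleCoord_cos_ne_zero {a : ℝ} (ha : 1 < a) :
    ∀ᶠ s in 𝓝 (0 : ℂ), Complex.cos (saddleCoord a s) ≠ 0 := by
  obtain ⟨⟨h1, h2, -, -⟩, -⟩ := saddleCoord_spec ha
  have : Tendsto (saddleCoord a) (𝓝 0) (𝓝 (saddle a)) := h2 ▸ h1.continuousAt.tendsto
  exact this.eventually (eventually_cos_ne_zero a)

/-- `tan u - √(a - 1)` as a function of the coordinate `s`. -/
noncomputable def tanCoord (a : ℝ) (s : ℂ) : ℂ :=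
  Complex.tan (saddleCoord a s) - Real.sqrt (a - 1)

theorem analyticAt_tanCoord {a : ℝ} (ha : 1 < a) : AnalyticAt ℂ (tanCoord a) 0 := by
  have h1 := (saddleCoord_spec ha).1.1
  rw [Complex.analyticAt_iff_eventually_differentiableAt] at h1 ⊢
  filter_upwards [h1, eventually_saddleCoord_cos_ne_zero ha] with s hs hc
  exact ((Complex.differentiableAt_tan.mpr hc).comp s hs).sub_const _

theorem tanCoord_zero {a : ℝ} (ha : 1 < a) : tanCoord a 0 = 0 := by
  rw [tanCoord, (saddleCoord_spec ha).1.2.1, ← Complex.ofReal_tan, tan_saddle, sub_self]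

theorem eventually_deriv_tanCoord {a : ℝ} (ha : 1 < a) :
    ∀ᶠ s in 𝓝 (0 : ℂ), deriv (tanCoord a) s = a * deriv (saddleCoord a) s + 2 * s ∧
      deriv (tanCoord a) s = (1 + (tanCoord a s + Real.sqrt (a - 1)) ^ 2) *
        deriv (saddleCoord a) s := by
  obtain ⟨⟨h1, -, -, h4⟩, -⟩ := saddleCoord_spec ha
  have h5 : tanCoord a =ᶠ[𝓝 0] fun s => a * saddleCoord a s + s ^ 2 +
      (Complex.tan (saddle a) - a * saddle a - Real.sqrt (a - 1)) := by
    filter_upwards [h4] with s hs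
    rw [tanCoord, ← hs, saddlePhase]
    ring
  have h1' := h1
  rw [Complex.analyticAt_iff_eventually_differentiableAt] at h1'
  filter_upwards [h5.deriv, h1', eventually_saddleCoord_cos_ne_zero ha] with s h6 h7 h8
  constructor
  · rw [h6]
    have := (((h7.hasDerivAt.const_mul (a : ℂ)).add (hasDerivAt_pow 2 s)).add_const
      (Complex.tan (saddle a) - a * saddle a - Real.sqrt (a - 1))).deriv
    refine Eq.trans this ?_
    simp
  · have := (((Complex.hasDerivAt_tan h8).comp s h7.hasDerivAt).sub_const
      ((Real.sqrt (a - 1) : ℝ) : ℂ)).deriv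
    refine Eq.trans this ?_
    have h9 := Complex.sin_sq_add_cos_sq (saddleCoord a s)
    rw [tanCoord, sub_add_cancel, Complex.tan]
    field_simp
    linear_combination -(deriv (saddleCoord a) s) * h9

/-- `A_{2k}` in terms of the expansion of `tan u`. -/
theorem ofReal_saddleCoeff_eq_maclaurin_tanCoord {a : ℝ} (ha : 1 < a) (k : ℕ) :
    (a : ℂ) * saddleCoeff a k =
      saddleScale a * ((2 * k + 1) * maclaurin (tanCoord a) (2 * k + 1)) := by
  have h : deriv (tanCoord a) =ᶠ[𝓝 0] fun s => a * deriv (saddleCoord a) s + 2 * s := by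
    filter_upwards [eventually_deriv_tanCoord ha] with s hs using hs.1
  have hU : AnalyticAt ℂ (deriv (saddleCoord a)) 0 := (saddleCoord_spec ha).1.1.deriv
  have h2 := maclaurin_congr h (2 * k)
  rw [maclaurin_deriv, maclaurin_add (f := fun s => a * deriv (saddleCoord a) s)
    (analyticAt_const.mul hU) (by fun_prop), maclaurin_const_mul, maclaurin_const_mul,
    maclaurin_id, if_neg (by omega), mul_zero, add_zero] at h2
  rw [ofReal_saddleCoeff ha]
  push_cast at h2
  rw [h2]
  ring

/-- The coefficients `r` of `Q = tan² u - (a - 1)`, as a function of `s`, and those of `tan u`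
satisfy a recursion, obtained by comparing coefficients in `Q (tan u)' = 2 s (a + Q)`. -/
theorem tanCoord_recursion {a : ℝ} (ha : 1 < a) :
    ∃ r : ℕ → ℂ, (∀ n, r n = 2 * Real.sqrt (a - 1) * maclaurin (tanCoord a) n +
        ∑ i ∈ Finset.range (n + 1), maclaurin (tanCoord a) i * maclaurin (tanCoord a) (n - i)) ∧
      ∀ n, ∑ i ∈ Finset.range (n + 3),
        r i * (((n + 2 - i : ℕ) + 1 : ℂ) * maclaurin (tanCoord a) (n + 2 - i + 1)) =
          2 * r (n + 1) := by
  set b : ℂ := ((Real.sqrt (a - 1) : ℝ) : ℂ) with hb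
  have hbsq : b ^ 2 = a - 1 := by
    rw [hb, ← Complex.ofReal_pow, Real.sq_sqrt (by linarith)]
    push_cast
    rfl
  have hE := analyticAt_tanCoord ha
  have hE' := hE.deriv
  set E := tanCoord a with hEdef
  set Q : ℂ → ℂ := fun s => 2 * b * E s + E s * E s with hQ
  have hQan : AnalyticAt ℂ Q 0 := (analyticAt_const.mul hE).add (hE.mul hE)
  have hode : (fun s => Q s * deriv E s) =ᶠ[𝓝 0] fun s => s * (2 * (a + Q s)) := by
    filter_upwards [eventually_deriv_tanCoord ha] with s hs
    obtain ⟨h1, h2⟩ := hs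
    have h3 : 1 + (E s + b) ^ 2 = a + Q s := by
      simp only [hQ]
      linear_combination hbsq
    rw [h3] at h2
    linear_combination (a + Q s) * h1 - a * h2
  refine ⟨maclaurin Q, fun n => ?_, fun n => ?_⟩
  · rw [hQ, maclaurin_add (f := fun s => 2 * b * E s) (g := fun s => E s * E s)
      (analyticAt_const.mul hE) (hE.mul hE), maclaurin_const_mul, maclaurin_mul hE hE]
  · have h1 := maclaurin_congr hode (n + 2)
    rw [maclaurin_mul hQan hE', maclaurin_id_mul_succ (by fun_prop), maclaurin_const_mul,
      maclaurin_add analyticAt_const hQan, maclaurin_const, if_neg (by omega), zero_add] at h1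
    simpa only [maclaurin_deriv] using h1

theorem saddleCoeff_zero {a : ℝ} (ha : 1 < a) : saddleCoeff a 0 = 1 := by
  have h := ofReal_saddleCoeff ha 0
  rw [mul_zero, maclaurin_zero, (saddleCoord_spec ha).1.2.2.1, mul_inv_cancel₀
    (by exact_mod_cast (saddleScale_pos ha).ne')] at h
  exact_mod_cast h

/-- The scaled coefficients `σ n = t_n γ^{3n-2} / a^n` of `tan u = √(a-1) + ∑ t_n s^n`, with
`γ² = a √(a - 1)`, satisfy the recursion of `scaled_coeff_values`, and
`A_{2k} = (2 k + 1) σ (2 k + 1) / (aᵏ √(a - 1)^{3k})`. -/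
theorem saddleCoeff_values {a : ℝ} (ha : 1 < a) :
    saddleCoeff a 1 = (8 - 12 * a + 9 * a ^ 2) / (24 * a * Real.sqrt (a - 1) ^ 3) ∧
    saddleCoeff a 2 = (64 - 192 * a + 288 * a ^ 2 + 360 * a ^ 3 - 135 * a ^ 4) /
        (3456 * a ^ 2 * Real.sqrt (a - 1) ^ 6) ∧
    saddleCoeff a 3 = (-71168 + 320256 * a - 554688 * a ^ 2 + 518400 * a ^ 3 + 340200 * a ^ 4
          - 170100 * a ^ 5 + 42525 * a ^ 6) / (6220800 * a ^ 3 * Real.sqrt (a - 1) ^ 9) ∧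
    saddleCoeff a 4 = (-2338816 + 14032896 * a - 36790272 * a ^ 2 + 55710720 * a ^ 3
          - 32876928 * a ^ 4 + 231880320 * a ^ 5 - 68584320 * a ^ 6
          + 30618000 * a ^ 7 - 5740875 * a ^ 8) /
        (4180377600 * a ^ 4 * Real.sqrt (a - 1) ^ 12) := by
  obtain ⟨r, hr, hrec⟩ := tanCoord_recursion ha
  have hA := ofReal_saddleCoeff_eq_maclaurin_tanCoord ha
  have hb0 : (Real.sqrt (a - 1) : ℂ) ≠ 0 := by
    exact_mod_cast (Real.sqrt_pos.mpr (by linarith)).ne'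
  have hbsq : (Real.sqrt (a - 1) : ℂ) ^ 2 = a - 1 := by
    rw [← Complex.ofReal_pow, Real.sq_sqrt (by linarith)]
    push_cast
    rfl
  have ha0 : (a : ℂ) ≠ 0 := by exact_mod_cast (by linarith : a ≠ 0)
  have hγ0 : (saddleScale a : ℂ) ≠ 0 := by exact_mod_cast (saddleScale_pos ha).ne'
  have hγsq : (saddleScale a : ℂ) ^ 2 = a * (Real.sqrt (a - 1) : ℂ) := by
    exact_mod_cast saddleScale_sq ha
  have ht0 : maclaurin (tanCoord a) 0 = 0 := by rw [maclaurin_zero, tanCoord_zero ha]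
  have ht1 : maclaurin (tanCoord a) 1 = a / saddleScale a := by
    have := hA 0
    rw [saddleCoeff_zero ha] at this
    simp only [Complex.ofReal_one, mul_one, Nat.cast_zero, mul_zero, zero_add, one_mul] at this
    rw [this]
    field_simp
  set t := maclaurin (tanCoord a)
  set b : ℂ := (Real.sqrt (a - 1) : ℂ) with hb
  set γ : ℂ := (saddleScale a : ℂ)
  set c : ℂ := γ ^ 3 / a with hc
  have hc0 : c ≠ 0 := div_ne_zero (pow_ne_zero 3 hγ0) ha0
  obtain ⟨h3, h5, h7, h9⟩ := scaled_coeff_values (a := (a : ℂ)) (σ := fun n => t n * c ^ n / γ ^ 2)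
    (R := fun n => r n * c ^ n * a / γ ^ 4) (by simp [ht0])
    (by simp only [ht1, hc]; field_simp)
    (by
      intro n
      rw [hr, add_mul, add_mul, add_div]
      congr 1
      · have : γ ^ 4 = a * b * γ ^ 2 := by rw [← hγsq]; ring
        rw [this]
        field_simp
      · rw [Finset.sum_mul, Finset.sum_mul, Finset.sum_div, Finset.mul_sum]
        refine Finset.sum_congr rfl fun i hi => ?_
        have hi' : i ≤ n := Nat.lt_succ_iff.mp (Finset.mem_range.mp hi)
        obtain ⟨j, rfl⟩ := Nat.exists_eq_add_of_le hi'
        rw [Nat.add_sub_cancel_left, pow_add]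
        field_simp)
    (by
      intro n
      have h := hrec n
      have hscale : 2 * ((a : ℂ) - 1) * (r (n + 1) * c ^ (n + 1) * a / γ ^ 4) =
          2 * r (n + 1) * (c ^ (n + 3) * a / γ ^ 6) := by
        have h6 : γ ^ 6 = (a * b) ^ 2 * γ ^ 2 := by rw [← hγsq]; ring
        have h4 : γ ^ 4 = (a * b) ^ 2 := by rw [← hγsq]; ring
        have hc2 : c ^ 2 = γ ^ 2 * b ^ 2 := by
          rw [hc, div_pow, ← pow_mul, show 3 * 2 = 6 by norm_num, h6]
          field_simp
        rw [pow_succ c (n + 2), pow_succ c (n + 1), mul_assoc (c ^ (n + 1)) c c, ← sq, hc2, h6, h4,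
          ← hbsq]
        field_simp
      rw [hscale, ← h, Finset.sum_mul]
      refine Finset.sum_congr rfl fun i hi => ?_
      have hi' : i ≤ n + 2 := Nat.lt_succ_iff.mp (Finset.mem_range.mp hi)
      obtain ⟨j, hj⟩ := Nat.exists_eq_add_of_le hi'
      rw [show n + 2 - i = j by omega, show n + 3 = i + (j + 1) by omega, pow_add c i]
      field_simp)
  have key : ∀ k : ℕ, (saddleCoeff a k : ℂ) =
      (2 * k + 1) * (t (2 * k + 1) * c ^ (2 * k + 1) / γ ^ 2) / (a ^ k * b ^ (3 * k)) := by
    intro k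
    have h := hA k
    have hck : c ^ (2 * k + 1) = γ ^ 3 / a * (a ^ k * b ^ (3 * k)) := by
      have h6 : γ ^ 6 = (a * b) ^ 3 := by rw [← hγsq]; ring
      rw [pow_succ, pow_mul, hc, div_pow, ← pow_mul, show 3 * 2 = 6 by norm_num, h6]
      have : ((a : ℂ) * b) ^ 3 / a ^ 2 = a * b ^ 3 := by field_simp
      rw [this, mul_pow, ← pow_mul]
      ring
    have h2 : (saddleCoeff a k : ℂ) = γ * ((2 * k + 1) * t (2 * k + 1)) / a := by
      rw [← h]; field_simp
    rw [h2, hck]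
    field_simp
  have k1 := key 1
  have k2 := key 2
  have k3 := key 3
  have k4 := key 4
  norm_num at k1 k2 k3 k4
  rw [h3] at k1
  rw [h5] at k2
  rw [h7] at k3
  rw [h9] at k4
  refine ⟨?_, ?_, ?_, ?_⟩ <;> rw [← Complex.ofReal_inj]
  · rw [k1]
    push_cast
    rw [← hb]
    field_simp
    ring
  · rw [k2]
    push_cast
    rw [← hb]
    field_simp
    ring
  · rw [k3]
    push_cast
    rw [← hb]
    field_simp
    ring
  · rw [k4]
    push_cast
    rw [← hb]
    field_simp
    ring

/-! ### The contribution of a saddle point -/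

open ComplexConjugate in
/-- On a small real interval the coordinate is real with positive derivative, and it turns the
phase into `s²` up to the critical value. -/
theorem exists_real_saddleCoord {a : ℝ} (ha : 1 < a) :
    ∃ δ : ℝ, 0 < δ ∧ ∀ s : ℝ, |s| ≤ δ → AnalyticAt ℂ (saddleCoord a) s ∧
      ((saddleCoord a s).re : ℂ) = saddleCoord a s ∧
      (((deriv (saddleCoord a) s).re : ℝ) : ℂ) = deriv (saddleCoord a) s ∧
      HasDerivAt (fun s : ℝ => (saddleCoord a s).re) (deriv (saddleCoord a) s).re s ∧
      0 < (deriv (saddleCoord a) s).re ∧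
      (saddleCoord a s).re ∈ Set.Ioo (-(Real.pi / 2)) (Real.pi / 2) ∧
      Real.tan (saddleCoord a s).re - a * (saddleCoord a s).re =
        Real.tan (saddle a) - a * saddle a + s ^ 2 := by
  obtain ⟨⟨h1, h2, h3, h4⟩, -⟩ := saddleCoord_spec ha
  have hre : ∀ᶠ z in 𝓝 (0 : ℂ),
      (saddleCoord a z).re ∈ Set.Ioo (-(Real.pi / 2)) (Real.pi / 2) := by
    have hc : ContinuousAt (fun z => (saddleCoord a z).re) 0 :=
      Complex.continuous_re.continuousAt.comp h1.continuousAt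
    refine hc.eventually_mem (isOpen_Ioo.mem_nhds ?_)
    rw [h2]
    exact saddle_mem a
  have hder : ∀ᶠ z in 𝓝 (0 : ℂ), 0 < (deriv (saddleCoord a) z).re := by
    have hc : ContinuousAt (fun z => (deriv (saddleCoord a) z).re) 0 :=
      Complex.continuous_re.continuousAt.comp h1.deriv.continuousAt
    refine hc.eventually_const_lt ?_
    change 0 < (deriv (saddleCoord a) 0).re
    rw [h3, ← Complex.ofReal_inv, Complex.ofReal_re]
    exact inv_pos.mpr (saddleScale_pos ha)
  obtain ⟨r, hr, hball⟩ := Metric.eventually_nhds_iff.mp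
    (h1.eventually_analyticAt.and (h4.and ((saddleCoord_conj ha).and (hre.and hder))))
  have hreal : ∀ s : ℝ, |s| < r → ((saddleCoord a s).re : ℂ) = saddleCoord a s := by
    intro s hs
    have h := (hball (y := (s : ℂ)) (by simpa using hs)).2.2.1
    simp only [Function.comp_apply, Complex.conj_ofReal] at h
    exact Complex.conj_eq_iff_re.mp h
  refine ⟨r / 2, half_pos hr, fun s hs => ?_⟩
  have hsr : |s| < r := by linarith
  obtain ⟨g1, g2, -, g4, g5⟩ := hball (y := (s : ℂ)) (by simpa using hsr)
  have hd : HasDerivAt (saddleCoord a) (deriv (saddleCoord a) s) (s : ℂ) :=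
    g1.differentiableAt.hasDerivAt
  have hdV : HasDerivAt (fun s : ℝ => (saddleCoord a s).re) (deriv (saddleCoord a) s).re s :=
    hd.real_of_complex
  refine ⟨g1, hreal s hsr, ?_, hdV, g5, g4, ?_⟩
  · refine hdV.ofReal_comp.unique (hd.comp_ofReal.congr_of_eventuallyEq ?_)
    have : ∀ᶠ t : ℝ in 𝓝 s, |t| < r := continuous_abs.continuousAt.eventually_lt_const hsr
    filter_upwards [this] with t ht
    exact hreal t ht
  · rw [saddlePhase, ← hreal s hsr, ← Complex.ofReal_tan, ← Complex.ofReal_tan] at g2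
    have : Real.tan (saddleCoord a s).re - a * (saddleCoord a s).re -
        (Real.tan (saddle a) - a * saddle a) = s ^ 2 := by exact_mod_cast g2
    linarith

/-- A bump at the saddle point isolates a contribution that, in the coordinate `s`, is a Fresnel
type integral with amplitude `du/ds` near `s = 0`. The bound on the support keeps the bump away from
the other stationary point. -/
theorem exists_bump_saddle_contribution {a : ℝ} (ha : 1 < a) :
    ∃ χ : ContDiffBump (saddle a), χ.rOut < 2 * saddle a ∧ ∀ K : ℕ, ∃ C : ℝ, ∀ x : ℝ, 1 ≤ x →
      ‖(∫ u in (-(Real.pi / 2))..(Real.pi / 2),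
          Complex.exp (Complex.I * (x * (Real.tan u - a * u) : ℝ)) * (χ u : ℂ))
        - Complex.exp (Complex.I * (x * (Real.tan (saddle a) - a * saddle a) : ℝ)) *
          ∑ k ∈ Finset.range K, (saddleScale a : ℂ)⁻¹ * saddleCoeff a k * fresnelMoment k x‖
        ≤ C / x ^ K := by
  obtain ⟨δ, hδ, hV⟩ := exists_real_saddleCoord ha
  set V : ℝ → ℝ := fun s => (saddleCoord a s).re with hVdef
  set V' : ℝ → ℝ := fun s => (deriv (saddleCoord a) s).re with hV'def
  have hIcc : ∀ s ∈ Set.Icc (-δ) δ, |s| ≤ δ := fun s hs => abs_le.mpr hs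
  have hδδ : -δ ≤ δ := by linarith
  have hVd : ∀ s ∈ Set.Icc (-δ) δ, HasDerivAt V (V' s) s := fun s hs => (hV s (hIcc s hs)).2.2.2.1
  have hVcont : ContinuousOn V (Set.Icc (-δ) δ) :=
    fun s hs => (hVd s hs).continuousAt.continuousWithinAt
  have hmono : StrictMonoOn V (Set.Icc (-δ) δ) := by
    refine strictMonoOn_of_deriv_pos (convex_Icc _ _) hVcont fun s hs => ?_
    rw [interior_Icc] at hs
    rw [(hVd s (Set.Ioo_subset_Icc_self hs)).deriv]
    exact (hV s (hIcc s (Set.Ioo_subset_Icc_self hs))).2.2.2.2.1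
  have hV0 : V 0 = saddle a := by
    simp only [hVdef, Complex.ofReal_zero]
    rw [(saddleCoord_spec ha).1.2.1, Complex.ofReal_re]
  have hleft : V (-δ) < saddle a := hV0 ▸ hmono ⟨le_rfl, hδδ⟩ ⟨by linarith, hδ.le⟩ (by linarith)
  have hright : saddle a < V δ := hV0 ▸ hmono ⟨by linarith, hδ.le⟩ ⟨hδδ, le_rfl⟩ hδ
  have hVl : V (-δ) ∈ Set.Ioo (-(Real.pi / 2)) (Real.pi / 2) :=
    (hV (-δ) (hIcc _ ⟨le_rfl, hδδ⟩)).2.2.2.2.2.1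
  have hVr : V δ ∈ Set.Ioo (-(Real.pi / 2)) (Real.pi / 2) :=
    (hV δ (hIcc _ ⟨hδδ, le_rfl⟩)).2.2.2.2.2.1
  obtain ⟨ε, hε0, hε⟩ := exists_between
    (lt_min (lt_min (sub_pos.mpr hleft) (sub_pos.mpr hright)) (saddle_pos ha))
  obtain ⟨⟨hε1, hε2⟩, hε3⟩ : (ε < saddle a - V (-δ) ∧ ε < V δ - saddle a) ∧ ε < saddle a := by
    simpa only [lt_min_iff] using hε
  let χ : ContDiffBump (saddle a) := ⟨ε / 2, ε, half_pos hε0, half_lt_self hε0⟩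
  have hχ0 : ∀ u : ℝ, ε ≤ |u - saddle a| → χ u = 0 := fun u hu =>
    χ.zero_of_le_dist (by simpa [Real.dist_eq] using hu)
  have hχd : ContDiff ℝ ∞ fun u : ℝ => ((χ u : ℝ) : ℂ) := contDiff_ofReal.comp χ.contDiff
  refine ⟨χ, by change ε < _; linarith [saddle_pos ha], fun K => ?_⟩
  -- the amplitude in the coordinate `s`, extended by zero
  set G : ℝ → ℂ := fun s =>
    open Classical in if s ∈ Set.Icc (-δ) δ then (χ (V s) : ℂ) * deriv (saddleCoord a) s else 0
    with hG
  have hGout : ∀ s : ℝ, s ∉ Set.Icc (-δ) δ → G s = 0 := fun s hs => if_neg hs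
  have hGin : ∀ s ∈ Set.Icc (-δ) δ, G s = (χ (V s) : ℂ) * deriv (saddleCoord a) s :=
    fun s hs => if_pos hs
  have hχl : χ (V (-δ)) = 0 := hχ0 _ (by rw [abs_of_neg (by linarith)]; linarith)
  have hχr : χ (V δ) = 0 := hχ0 _ (by rw [abs_of_pos (by linarith)]; linarith)
  have hGsupp : ∀ s : ℝ, s ∉ Set.Ioo (-δ) δ → ∀ᶠ t in 𝓝 s, G t = 0 := by
    intro s hs
    by_cases hs' : s ∈ Set.Icc (-δ) δ
    · have hend : ε < |V s - saddle a| := by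
        rcases eq_or_lt_of_le hs'.1 with h | h
        · rw [← h, abs_of_neg (by linarith)]; linarith
        · rcases eq_or_lt_of_le hs'.2 with h' | h'
          · rw [h', abs_of_pos (by linarith)]; linarith
          · exact absurd ⟨h, h'⟩ hs
      have hc : ContinuousAt (fun t => |V t - saddle a|) s :=
        ((hVd s hs').continuousAt.sub continuousAt_const).abs
      filter_upwards [hc.eventually_const_lt hend] with t ht
      by_cases h : t ∈ Set.Icc (-δ) δ
      · rw [hGin t h, hχ0 _ ht.le, Complex.ofReal_zero, zero_mul]
      · exact hGout t h
    · filter_upwards [isClosed_Icc.isOpen_compl.mem_nhds hs'] with t ht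
      exact hGout t ht
  have hGd : ContDiff ℝ ∞ G := by
    rw [contDiff_iff_contDiffAt]
    intro s
    by_cases hs : s ∈ Set.Ioo (-δ) δ
    · have han := (hV s (hIcc s (Set.Ioo_subset_Icc_self hs))).1
      have hres : ∀ f : ℂ → ℂ, AnalyticAt ℂ f s → ContDiffAt ℝ ∞ (fun t : ℝ => f t) s := by
        intro f hf
        have h1 : ContDiffAt ℝ ∞ f ((s : ℝ) : ℂ) := (hf.contDiffAt (n := ∞)).restrict_scalars ℝ
        exact h1.comp s contDiff_ofReal.contDiffAt
      have hVs : ContDiffAt ℝ ∞ V s :=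
        Complex.reCLM.contDiff.contDiffAt.comp s (hres _ han)
      refine ((hχd.contDiffAt.comp s hVs).mul (hres _ han.deriv)).congr_of_eventuallyEq ?_
      filter_upwards [isOpen_Ioo.mem_nhds hs] with t ht
      exact hGin t (Set.Ioo_subset_Icc_self ht)
    · exact contDiffAt_const.congr_of_eventuallyEq (hGsupp s hs)
  have hGc : HasCompactSupport G := HasCompactSupport.intro isCompact_Icc hGout
  have hG0 : ∀ᶠ s in 𝓝 (0 : ℝ), G s = deriv (saddleCoord a) s := by
    have hc : Tendsto V (𝓝 0) (𝓝 (saddle a)) :=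
      hV0 ▸ (hVd 0 ⟨by linarith, hδ.le⟩).continuousAt.tendsto
    filter_upwards [hc.eventually χ.eventuallyEq_one,
      isOpen_Ioo.mem_nhds (show (0 : ℝ) ∈ Set.Ioo (-δ) δ from ⟨by linarith, hδ⟩)] with s h1 h2
    rw [hGin s (Set.Ioo_subset_Icc_self h2), h1]
    simp
  obtain ⟨C, hC⟩ := exists_norm_integral_sub_sum_fresnelMoment_le hGd hGc
    (saddleCoord_spec ha).1.1.deriv hG0 K
  refine ⟨C, fun x hx => ?_⟩
  set E₀ := Complex.exp (Complex.I * (x * (Real.tan (saddle a) - a * saddle a) : ℝ)) with hE₀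
  have hcv : (∫ u in (-(Real.pi / 2))..(Real.pi / 2),
      Complex.exp (Complex.I * (x * (Real.tan u - a * u) : ℝ)) * (χ u : ℂ)) =
      E₀ * ∫ s : ℝ, Complex.exp (-(-(Complex.I * x)) * (s : ℂ) ^ 2) * G s := by
    set g : ℝ → ℂ := fun u => Complex.exp (Complex.I * (x * (Real.tan u - a * u) : ℝ)) * (χ u : ℂ)
      with hg
    have hgsupp : Function.support g ⊆ Set.Ioc (V (-δ)) (V δ) := by
      intro u hu
      by_contra hcon
      refine hu ?_
      have : ε ≤ |u - saddle a| := by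
        rw [Set.mem_Ioc, not_and_or, not_lt, not_le] at hcon
        rcases hcon with h | h
        · rw [abs_of_neg (by linarith)]; linarith
        · rw [abs_of_pos (by linarith)]; linarith
      simp only [hg, hχ0 u this, Complex.ofReal_zero, mul_zero]
    have h1 : ∫ u in (-(Real.pi / 2))..(Real.pi / 2), g u = ∫ u in (V (-δ))..(V δ), g u := by
      rw [intervalIntegral.integral_eq_integral_of_support_subset hgsupp,
        intervalIntegral.integral_eq_integral_of_support_subset
          (hgsupp.trans (Set.Ioc_subset_Ioc hVl.1.le hVr.2.le))]
    have hmaps : V '' Set.uIcc (-δ) δ ⊆ Set.Ioo (-(Real.pi / 2)) (Real.pi / 2) := by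
      rintro _ ⟨s, hs, rfl⟩
      rw [Set.uIcc_of_le hδδ] at hs
      exact (hV s (hIcc s hs)).2.2.2.2.2.1
    have hgcont : ContinuousOn g (V '' Set.uIcc (-δ) δ) := by
      refine ContinuousOn.mono (fun u hu => ?_) hmaps
      have h2 := (hasDerivAt_phase (a := a) (cos_ne_zero_of_mem_Ioo hu)).continuousAt
      have h3 : ContinuousAt
          (fun u => Complex.exp (Complex.I * (x * (Real.tan u - a * u) : ℝ))) u :=
        (continuousAt_const.mul
          (Complex.continuous_ofReal.continuousAt.comp (continuousAt_const.mul h2))).cexp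
      exact (h3.mul hχd.continuous.continuousAt).continuousWithinAt
    have h2 := intervalIntegral.integral_deriv_smul_comp' (f := V) (f' := V') (g := g)
      (a := -δ) (b := δ) (fun s hs => hVd s (by rwa [Set.uIcc_of_le hδδ] at hs))
      (by
        rw [Set.uIcc_of_le hδδ]
        intro s hs
        have := (hV s (hIcc s hs)).1.deriv.continuousAt
        exact (Complex.continuous_re.continuousAt.comp
          (this.comp Complex.continuous_ofReal.continuousAt)).continuousWithinAt) hgcont
    rw [h1, ← h2, ← integral_const_mul,
      ← intervalIntegral.integral_eq_integral_of_support_subset (a := -δ) (b := δ)]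
    · refine intervalIntegral.integral_congr fun s hs => ?_
      rw [Set.uIcc_of_le hδδ] at hs
      obtain ⟨-, -, h5, -, -, -, h8⟩ := hV s (hIcc s hs)
      simp only [Function.comp_apply, hg, hGin s hs, hE₀]
      have h9 : Real.tan (V s) - a * V s = Real.tan (saddle a) - a * saddle a + s ^ 2 := h8
      rw [h9, Complex.real_smul, show ((V' s : ℝ) : ℂ) = deriv (saddleCoord a) s from h5,
        ← mul_assoc (Complex.exp _) (Complex.exp _), ← Complex.exp_add]
      rw [show Complex.I * ((x * (Real.tan (saddle a) - a * saddle a) : ℝ) : ℂ) +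
        -(-(Complex.I * x)) * (s : ℂ) ^ 2 =
        Complex.I * ((x * (Real.tan (saddle a) - a * saddle a + s ^ 2) : ℝ) : ℂ) by
          push_cast; ring]
      ring
    · intro s hs
      by_contra hcon
      refine hs ?_
      have : G s = 0 := (hGsupp s fun h => hcon (Set.Ioo_subset_Ioc_self h)).self_of_nhds
      simp only [this, mul_zero]
  rw [hcv, ← mul_sub, norm_mul, hE₀, norm_cexp_I_mul_ofReal, one_mul]
  refine le_trans (le_of_eq ?_) (hC x hx)
  congr 2
  refine Finset.sum_congr rfl fun k _ => ?_
  rw [← maclaurin_deriv_saddleCoord ha]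
  rfl

/-! ### The expansion of the Bateman function -/

theorem batemanK_eq_re (a x : ℝ) :
    batemanK (a * x) x = 1 / Real.pi * (∫ u in (-(Real.pi / 2))..(Real.pi / 2),
      Complex.exp (Complex.I * (x * (Real.tan u - a * u) : ℝ))).re := by
  have hint : ∀ b c : ℝ, IntervalIntegrable (fun u : ℝ =>
      Complex.exp (Complex.I * (x * (Real.tan u - a * u) : ℝ))) volume b c := by
    intro b c
    simpa using intervalIntegrable_cexp_phase_mul (h := fun _ => 1) (b := b) (c := c) a x
      continuousOn_const
  have hre : ∀ u : ℝ, (Complex.exp (Complex.I * (x * (Real.tan u - a * u) : ℝ))).re =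
      Real.cos (x * Real.tan u - a * x * u) := by
    intro u
    rw [mul_comm, Complex.exp_ofReal_mul_I_re]
    congr 1
    ring
  have hcos : ∀ b c : ℝ, IntervalIntegrable
      (fun u : ℝ => Real.cos (x * Real.tan u - a * x * u)) volume b c := by
    intro b c
    simp only [← hre]
    exact ⟨(hint b c).1.re, (hint b c).2.re⟩
  have h1 : (∫ u in (-(Real.pi / 2))..(Real.pi / 2),
      Complex.exp (Complex.I * (x * (Real.tan u - a * u) : ℝ))).re =
      ∫ u in (-(Real.pi / 2))..(Real.pi / 2), Real.cos (x * Real.tan u - a * x * u) := by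
    simp only [← hre]
    exact (Complex.reCLM.intervalIntegral_comp_comm (hint _ _)).symm
  have h2 : ∫ u in (-(Real.pi / 2))..0, Real.cos (x * Real.tan u - a * x * u) =
      ∫ u in (0 : ℝ)..(Real.pi / 2), Real.cos (x * Real.tan u - a * x * u) := by
    have := intervalIntegral.integral_comp_neg (a := 0) (b := Real.pi / 2)
      fun u => Real.cos (x * Real.tan u - a * x * u)
    rw [neg_zero] at this
    rw [← this]
    refine intervalIntegral.integral_congr fun u _ => ?_
    simp only [Real.tan_neg]
    rw [← Real.cos_neg]
    congr 1
    ring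
  rw [h1, ← intervalIntegral.integral_add_adjacent_intervals (hcos _ 0) (hcos 0 _), h2, batemanK]
  ring

open ComplexConjugate in
/-- Reflecting the amplitude conjugates the integral, since the phase is odd. -/
theorem integral_phase_comp_neg (a x : ℝ) (χ : ℝ → ℝ) :
    ∫ u in (-(Real.pi / 2))..(Real.pi / 2),
      Complex.exp (Complex.I * (x * (Real.tan u - a * u) : ℝ)) * (χ (-u) : ℂ) =
    conj (∫ u in (-(Real.pi / 2))..(Real.pi / 2),
      Complex.exp (Complex.I * (x * (Real.tan u - a * u) : ℝ)) * (χ u : ℂ)) := by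
  have h := intervalIntegral.integral_comp_neg (a := -(Real.pi / 2)) (b := Real.pi / 2)
    fun u => Complex.exp (Complex.I * (x * (Real.tan (-u) - a * (-u)) : ℝ)) * (χ u : ℂ)
  simp only [neg_neg] at h
  rw [h]
  have hpi : -(Real.pi / 2) ≤ Real.pi / 2 := by linarith [Real.pi_pos]
  rw [intervalIntegral.integral_of_le hpi, intervalIntegral.integral_of_le hpi, ← integral_conj]
  congr 1
  funext u
  rw [map_mul, ← Complex.exp_conj, map_mul, Complex.conj_I, Complex.conj_ofReal,
    Complex.conj_ofReal, Real.tan_neg]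
  congr 2
  push_cast
  ring

/-- Up to errors of arbitrarily high order, the Bateman function is given by the contribution of
the positive saddle point; the negative one contributes the complex conjugate. -/
theorem exists_abs_batemanK_sub_le {a : ℝ} (ha : 1 < a) (K : ℕ) :
    ∃ C : ℝ, ∀ x : ℝ, 1 ≤ x →
      |batemanK (a * x) x - 2 / Real.pi *
        (Complex.exp (Complex.I * (x * (Real.tan (saddle a) - a * saddle a) : ℝ)) *
          ∑ k ∈ Finset.range K, (saddleScale a : ℂ)⁻¹ * saddleCoeff a k * fresnelMoment k x).re|
        ≤ C / x ^ K := by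
  obtain ⟨χ, hχr, hχ⟩ := exists_bump_saddle_contribution ha
  obtain ⟨C₁, hC₁⟩ := hχ K
  have hχd : ContDiff ℝ ∞ fun u : ℝ => ((χ u : ℝ) : ℂ) := contDiff_ofReal.comp χ.contDiff
  have hχd' : ContDiff ℝ ∞ fun u : ℝ => ((χ (-u) : ℝ) : ℂ) := hχd.comp contDiff_neg
  set h : ℝ → ℂ := fun u => 1 - (χ u : ℂ) - (χ (-u) : ℂ) with hh
  have hhd : ContDiff ℝ ∞ h := (contDiff_const.sub hχd).sub hχd'
  have hpos := saddle_pos ha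
  have hone : ∀ᶠ u in 𝓝 (saddle a), χ u = 1 := χ.eventuallyEq_one
  have hzero : ∀ᶠ u in 𝓝 (-saddle a), χ u = 0 := by
    have hc : ContinuousAt (fun u => dist u (saddle a)) (-saddle a) := by fun_prop
    have h1 : χ.rOut < dist (-saddle a) (saddle a) := by
      rw [Real.dist_eq, abs_of_neg (by linarith)]
      linarith
    filter_upwards [hc.eventually_const_lt h1] with u hu
    exact χ.zero_of_le_dist hu.le
  have hneg : ∀ c : ℝ, Tendsto (fun u : ℝ => -u) (𝓝 c) (𝓝 (-c)) := fun c => tendsto_neg c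
  have hs1 : h =ᶠ[𝓝 (saddle a)] 0 := by
    filter_upwards [hone, (hneg (saddle a)).eventually hzero] with u h1 h2
    simp [hh, h1, h2]
  have hs2 : h =ᶠ[𝓝 (-saddle a)] 0 := by
    have h3 := hneg (-saddle a)
    rw [neg_neg] at h3
    filter_upwards [hzero, h3.eventually hone] with u h1 h2
    simp [hh, h1, h2]
  obtain ⟨C₂, hC₂⟩ := exists_norm_integral_phase_le ha K h (fun u _ => hhd.contDiffAt) hs1 hs2
  refine ⟨1 / Real.pi * (C₂ + 2 * C₁), fun x hx => ?_⟩
  have h1 := hC₁ x hx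
  have h2 := hC₂ x (by linarith)
  set S := Complex.exp (Complex.I * (x * (Real.tan (saddle a) - a * saddle a) : ℝ)) *
    ∑ k ∈ Finset.range K, (saddleScale a : ℂ)⁻¹ * saddleCoeff a k * fresnelMoment k x
  have hi1 := intervalIntegrable_cexp_phase_mul (b := -(Real.pi / 2)) (c := Real.pi / 2) a x
    hχd.continuous.continuousOn
  have hi2 := intervalIntegrable_cexp_phase_mul (b := -(Real.pi / 2)) (c := Real.pi / 2) a x
    hχd'.continuous.continuousOn
  have hi3 := intervalIntegrable_cexp_phase_mul (b := -(Real.pi / 2)) (c := Real.pi / 2) a x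
    hhd.continuous.continuousOn
  have hsplit : (∫ u in (-(Real.pi / 2))..(Real.pi / 2),
      Complex.exp (Complex.I * (x * (Real.tan u - a * u) : ℝ))) =
      (∫ u in (-(Real.pi / 2))..(Real.pi / 2),
        Complex.exp (Complex.I * (x * (Real.tan u - a * u) : ℝ)) * h u) +
      (∫ u in (-(Real.pi / 2))..(Real.pi / 2),
        Complex.exp (Complex.I * (x * (Real.tan u - a * u) : ℝ)) * (χ u : ℂ)) +
      ∫ u in (-(Real.pi / 2))..(Real.pi / 2),
        Complex.exp (Complex.I * (x * (Real.tan u - a * u) : ℝ)) * (χ (-u) : ℂ) := by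
    rw [← intervalIntegral.integral_add hi3 hi1, ← intervalIntegral.integral_add (hi3.add hi1) hi2]
    refine intervalIntegral.integral_congr fun u _ => ?_
    simp only [hh]
    ring
  rw [batemanK_eq_re, hsplit, integral_phase_comp_neg, Complex.add_re, Complex.add_re,
    Complex.conj_re]
  set J₀ := ∫ u in (-(Real.pi / 2))..(Real.pi / 2),
        Complex.exp (Complex.I * (x * (Real.tan u - a * u) : ℝ)) * h u
  set J₁ := ∫ u in (-(Real.pi / 2))..(Real.pi / 2),
        Complex.exp (Complex.I * (x * (Real.tan u - a * u) : ℝ)) * (χ u : ℂ)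
  have h3 : |J₀.re| ≤ C₂ / x ^ K := (Complex.abs_re_le_norm _).trans h2
  have h4 : |J₁.re - S.re| ≤ C₁ / x ^ K := by
    rw [← Complex.sub_re]
    exact (Complex.abs_re_le_norm _).trans h1
  have h5 : 1 / Real.pi * (J₀.re + J₁.re + J₁.re) - 2 / Real.pi * S.re =
      1 / Real.pi * (J₀.re + 2 * (J₁.re - S.re)) := by ring
  rw [h5, abs_mul, abs_of_pos (by positivity : 0 < 1 / Real.pi), mul_div_assoc]
  refine mul_le_mul_of_nonneg_left ?_ (by positivity)
  calc |J₀.re + 2 * (J₁.re - S.re)| ≤ |J₀.re| + |2 * (J₁.re - S.re)| := abs_add_le _ _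
    _ = |J₀.re| + 2 * |J₁.re - S.re| := by rw [abs_mul, abs_two]
    _ ≤ C₂ / x ^ K + 2 * (C₁ / x ^ K) := by linarith
    _ = (C₂ + 2 * C₁) / x ^ K := by ring

theorem fresnelMoment_eq {x : ℝ} (hx : 0 < x) (k : ℕ) :
    fresnelMoment k x = ((Real.sqrt (Real.pi / x) * poch (1 / 2) k / x ^ k : ℝ) : ℂ) *
      (Complex.exp (Complex.I * (Real.pi / 4 : ℝ)) * Complex.I ^ k) := by
  have hxc : (x : ℂ) ≠ 0 := by exact_mod_cast hx.ne'
  have hr : 0 < Real.pi / x := by positivity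
  have h1 : (Real.pi : ℂ) / (-(Complex.I * x)) = ((Real.pi / x : ℝ) : ℂ) * Complex.I := by
    push_cast
    field_simp
    simp
  have h2 : ((Real.pi : ℂ) / (-(Complex.I * x))) ^ (1 / 2 : ℂ) =
      (Real.sqrt (Real.pi / x) : ℂ) * Complex.exp (Complex.I * (Real.pi / 4 : ℝ)) := by
    rw [h1, Complex.cpow_def_of_ne_zero
      (mul_ne_zero (by exact_mod_cast hr.ne') Complex.I_ne_zero),
      Complex.log_ofReal_mul hr Complex.I_ne_zero, Complex.log_I, add_mul, Complex.exp_add,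
      Real.sqrt_eq_rpow, Real.rpow_def_of_pos hr]
    push_cast
    congr 2
    ring
  have h3 : (1 : ℂ) / (-(Complex.I * x)) ^ k = Complex.I ^ k / (x : ℂ) ^ k := by
    rw [← one_div_pow, ← div_pow]
    congr 1
    field_simp
    simp
  rw [fresnelMoment, h2, mul_div_assoc, div_eq_mul_one_div (poch _ _ : ℂ), h3]
  push_cast
  ring

theorem poch_half_succ (n : ℕ) : poch (1 / 2) (n + 1) = 1 / 2 * poch (3 / 2) n := by
  induction n with
  | zero => simp [poch]
  | succ n ih =>
    rw [poch_succ, ih, poch_succ]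
    push_cast
    ring

theorem phasePhi_eq (a x : ℝ) :
    phasePhi a x = x * (Real.tan (saddle a) - a * saddle a) + Real.pi / 4 := by
  rw [phasePhi, tan_saddle]
  rfl

theorem prefactor_eq {a x : ℝ} (ha : 1 < a) (hx : 0 < x) :
    2 / Real.pi * ((saddleScale a)⁻¹ * Real.sqrt (Real.pi / x)) =
      2 * (a - 1) ^ (-1 / 4 : ℝ) / Real.sqrt (Real.pi * a * x) := by
  have ha1 : 0 < a - 1 := by linarith
  have h1 : saddleScale a = Real.sqrt a * (a - 1) ^ (1 / 4 : ℝ) := by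
    rw [saddleScale, Real.sqrt_mul (by linarith), Real.sqrt_eq_rpow (Real.sqrt _),
      Real.sqrt_eq_rpow (a - 1), ← Real.rpow_mul ha1.le]
    norm_num
  have h2 : (a - 1) ^ (-1 / 4 : ℝ) = ((a - 1) ^ (1 / 4 : ℝ))⁻¹ := by
    rw [← Real.rpow_neg ha1.le]
    norm_num
  have h3 : Real.sqrt (Real.pi * a * x) = Real.sqrt Real.pi * Real.sqrt a * Real.sqrt x := by
    rw [Real.sqrt_mul (by positivity), Real.sqrt_mul Real.pi_pos.le]
  have h4 : 0 < (a - 1) ^ (1 / 4 : ℝ) := Real.rpow_pos_of_pos ha1 _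
  have h5 : 0 < Real.sqrt a := Real.sqrt_pos.mpr (by linarith)
  have h6 : 0 < Real.sqrt x := Real.sqrt_pos.mpr hx
  have h7 : 0 < Real.sqrt Real.pi := Real.sqrt_pos.mpr Real.pi_pos
  rw [h1, h2, h3, Real.sqrt_div Real.pi_pos.le]
  nth_rewrite 1 [← Real.sq_sqrt Real.pi_pos.le]
  field_simp

/-- As the `k`-th Fresnel moment carries the factor `iᵏ`, the terms of even index form the cosine
series and those of odd index the sine series. -/
theorem re_saddle_sum_eq_partialExpansion {a x : ℝ} (ha : 1 < a) (hx : 0 < x) (L : ℕ) :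
    2 / Real.pi * (Complex.exp (Complex.I * (x * (Real.tan (saddle a) - a * saddle a) : ℝ)) *
      ∑ k ∈ Finset.range (2 * L), (saddleScale a : ℂ)⁻¹ * saddleCoeff a k * fresnelMoment k x).re =
      partialExpansion a (saddleCoeff a) L L x := by
  have hterm : ∀ k : ℕ,
      (Complex.exp (Complex.I * (x * (Real.tan (saddle a) - a * saddle a) : ℝ)) *
        ((saddleScale a : ℂ)⁻¹ * saddleCoeff a k * fresnelMoment k x)).re =
      (saddleScale a)⁻¹ * Real.sqrt (Real.pi / x) * (saddleCoeff a k * poch (1 / 2) k / x ^ k *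
        (Complex.exp (phasePhi a x * Complex.I) * Complex.I ^ k).re) := by
    intro k
    rw [fresnelMoment_eq hx, phasePhi_eq]
    have : Complex.exp (Complex.I * (x * (Real.tan (saddle a) - a * saddle a) : ℝ)) *
        ((saddleScale a : ℂ)⁻¹ * saddleCoeff a k *
          (((Real.sqrt (Real.pi / x) * poch (1 / 2) k / x ^ k : ℝ) : ℂ) *
          (Complex.exp (Complex.I * (Real.pi / 4 : ℝ)) * Complex.I ^ k))) =
        (((saddleScale a)⁻¹ * Real.sqrt (Real.pi / x) *
          (saddleCoeff a k * poch (1 / 2) k / x ^ k) : ℝ) : ℂ) *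
        (Complex.exp (((x * (Real.tan (saddle a) - a * saddle a) + Real.pi / 4 : ℝ) : ℂ) *
          Complex.I) * Complex.I ^ k) := by
      have hexp : Complex.exp (((x * (Real.tan (saddle a) - a * saddle a) + Real.pi / 4 : ℝ) : ℂ) *
          Complex.I) = Complex.exp (Complex.I * (x * (Real.tan (saddle a) - a * saddle a) : ℝ)) *
          Complex.exp (Complex.I * (Real.pi / 4 : ℝ)) := by
        rw [← Complex.exp_add]
        congr 1
        push_cast
        ring
      rw [hexp]
      push_cast
      ring
    rw [this, Complex.re_ofReal_mul]
    ring
  have heven : ∀ j : ℕ, (Complex.exp (phasePhi a x * Complex.I) * Complex.I ^ (2 * j)).re =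
      (-1) ^ j * Real.cos (phasePhi a x) := by
    intro j
    rw [pow_mul, Complex.I_sq, mul_comm, ← Complex.exp_ofReal_mul_I_re,
      show ((-1 : ℂ)) ^ j = (((-1) ^ j : ℝ) : ℂ) by push_cast; rfl, Complex.re_ofReal_mul]
  have hodd : ∀ j : ℕ, (Complex.exp (phasePhi a x * Complex.I) * Complex.I ^ (2 * j + 1)).re =
      -((-1) ^ j * Real.sin (phasePhi a x)) := by
    intro j
    rw [pow_succ, pow_mul, Complex.I_sq, ← Complex.exp_ofReal_mul_I_im,
      show Complex.exp (phasePhi a x * Complex.I) * ((-1 : ℂ) ^ j * Complex.I) =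
        (((-1) ^ j : ℝ) : ℂ) * (Complex.exp (phasePhi a x * Complex.I) * Complex.I) by
          push_cast; ring, Complex.re_ofReal_mul, Complex.mul_I_re]
    ring
  rw [Finset.mul_sum, Complex.re_sum]
  simp only [hterm]
  rw [← Finset.mul_sum, ← mul_assoc, prefactor_eq ha hx, partialExpansion, sum_range_two_mul,
    Finset.sum_add_distrib]
  congr 1
  rw [sub_eq_add_neg, Finset.mul_sum, Finset.mul_sum, ← Finset.sum_neg_distrib]
  congr 1
  · refine Finset.sum_congr rfl fun j _ => ?_
    rw [heven]
    ring
  · refine Finset.sum_congr rfl fun j _ => ?_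
    rw [hodd, poch_half_succ, pow_succ]
    field_simp

theorem abs_sum_range_sub_sum_range_le (c : ℕ → ℝ) {M L : ℕ} (hML : M ≤ L) {x : ℝ} (hx : 1 ≤ x) :
    |∑ k ∈ Finset.range L, c k / x ^ (2 * k) - ∑ k ∈ Finset.range M, c k / x ^ (2 * k)| ≤
      (∑ k ∈ Finset.range L, |c k|) / x ^ (2 * M) := by
  rw [Finset.sum_range_sub_sum_range hML, Finset.sum_div]
  refine (Finset.abs_sum_le_sum_abs _ _).trans ((Finset.sum_le_sum fun k hk => ?_).trans
    (Finset.sum_le_sum_of_subset_of_nonneg (Finset.filter_subset _ _) fun k _ _ => by positivity))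
  have hk' : M ≤ k := (Finset.mem_filter.mp hk).2
  rw [abs_div, abs_of_nonneg (by positivity : 0 ≤ x ^ (2 * k))]
  exact div_le_div_of_nonneg_left (abs_nonneg _) (by positivity)
    (pow_le_pow_right₀ hx (by omega))

/-- Terms of an expansion beyond the truncation orders are of the size of the stated error. -/
theorem exists_abs_partialExpansion_sub_le (a : ℝ) (A : ℕ → ℝ) (ha : 0 < a) {M N L : ℕ}
    (hM : M ≤ L) (hN : N ≤ L) :
    ∃ C : ℝ, ∀ x : ℝ, 1 ≤ x → |partialExpansion a A L L x - partialExpansion a A M N x| ≤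
      C * (x ^ (-1 / 2 : ℝ) * (1 / x ^ (2 * M) + 1 / x ^ (2 * N + 1))) := by
  set c : ℕ → ℝ := fun k => (-1) ^ k * A (2 * k) * poch (1 / 2) (2 * k) with hc
  set d : ℕ → ℝ := fun k => (-1) ^ k * A (2 * k + 1) * poch (3 / 2) (2 * k) with hd
  set C₁ := ∑ k ∈ Finset.range L, |c k|
  set C₂ := ∑ k ∈ Finset.range L, |d k|
  have hC₁ : 0 ≤ C₁ := Finset.sum_nonneg fun k _ => abs_nonneg _
  have hC₂ : 0 ≤ C₂ := Finset.sum_nonneg fun k _ => abs_nonneg _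
  set P := |2 * (a - 1) ^ (-1 / 4 : ℝ)| / Real.sqrt (Real.pi * a) with hP
  have hP0 : 0 ≤ P := by positivity
  refine ⟨P * (C₁ + C₂), fun x hx => ?_⟩
  have hx0 : 0 < x := by linarith
  have h1 := abs_sum_range_sub_sum_range_le c hM hx
  have h2 := abs_sum_range_sub_sum_range_le d hN hx
  simp only [partialExpansion]
  rw [← mul_sub, abs_mul]
  have hpre : |2 * (a - 1) ^ (-1 / 4 : ℝ) / Real.sqrt (Real.pi * a * x)| =
      P * x ^ (-1 / 2 : ℝ) := by
    have hx2 : x ^ (-1 / 2 : ℝ) = (Real.sqrt x)⁻¹ := by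
      rw [Real.sqrt_eq_rpow, ← Real.rpow_neg hx0.le]
      norm_num
    rw [abs_div, abs_of_nonneg (Real.sqrt_nonneg _), Real.sqrt_mul (by positivity), hx2, hP]
    field_simp
  rw [hpre, mul_assoc, mul_assoc]
  refine mul_le_mul_of_nonneg_left ?_ hP0
  rw [mul_left_comm]
  refine mul_le_mul_of_nonneg_left ?_ (by positivity)
  set X := ∑ k ∈ Finset.range L, c k / x ^ (2 * k)
  set X' := ∑ k ∈ Finset.range M, c k / x ^ (2 * k)
  set Y := ∑ k ∈ Finset.range L, d k / x ^ (2 * k)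
  set Y' := ∑ k ∈ Finset.range N, d k / x ^ (2 * k)
  have hcos := Real.abs_cos_le_one (phasePhi a x)
  have hsin := Real.abs_sin_le_one (phasePhi a x)
  have h3 : |Real.cos (phasePhi a x) * (X - X')| ≤ C₁ / x ^ (2 * M) := by
    rw [abs_mul]
    exact (mul_le_of_le_one_left (abs_nonneg _) hcos).trans h1
  have h4 : |Real.sin (phasePhi a x) / (2 * x) * (Y - Y')| ≤ C₂ / x ^ (2 * N + 1) := by
    rw [abs_mul, abs_div, abs_of_pos (by positivity : 0 < 2 * x), pow_succ, div_mul_eq_mul_div,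
      div_le_div_iff₀ (by positivity) (by positivity)]
    rw [le_div_iff₀ (by positivity)] at h2
    have h5 : |Real.sin (phasePhi a x)| * |Y - Y'| ≤ |Y - Y'| :=
      mul_le_of_le_one_left (abs_nonneg _) hsin
    calc |Real.sin (phasePhi a x)| * |Y - Y'| * (x ^ (2 * N) * x)
        ≤ |Y - Y'| * (x ^ (2 * N) * x) := mul_le_mul_of_nonneg_right h5 (by positivity)
      _ = |Y - Y'| * x ^ (2 * N) * x := by ring
      _ ≤ C₂ * x := mul_le_mul_of_nonneg_right h2 hx0.le
      _ ≤ C₂ * (2 * x) := by nlinarith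
  have h6 : Real.cos (phasePhi a x) * X - Real.sin (phasePhi a x) / (2 * x) * Y -
      (Real.cos (phasePhi a x) * X' - Real.sin (phasePhi a x) / (2 * x) * Y') =
      Real.cos (phasePhi a x) * (X - X') - Real.sin (phasePhi a x) / (2 * x) * (Y - Y') := by ring
  rw [h6]
  have h7 : C₁ / x ^ (2 * M) + C₂ / x ^ (2 * N + 1) ≤
      (C₁ + C₂) * (1 / x ^ (2 * M) + 1 / x ^ (2 * N + 1)) := by
    have h8 : 0 ≤ C₁ * (1 / x ^ (2 * N + 1)) := by positivity
    have h9 : 0 ≤ C₂ * (1 / x ^ (2 * M)) := by positivity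
    rw [div_eq_mul_one_div C₁, div_eq_mul_one_div C₂]
    linarith
  exact (abs_sub _ _).trans ((add_le_add h3 h4).trans h7)

theorem batemanK_sub_partialExpansion_isBigO {a : ℝ} (ha : 1 < a) (M N : ℕ) :
    (fun x : ℝ => batemanK (a * x) x - partialExpansion a (saddleCoeff a) M N x) =O[atTop]
      (fun x : ℝ => x ^ (-1 / 2 : ℝ) * (1 / x ^ (2 * M) + 1 / x ^ (2 * N + 1))) := by
  -- `2 (M + N + 1)` terms of the saddle point sum are `M + N + 1` terms in each series
  obtain ⟨C₁, hC₁⟩ := exists_abs_batemanK_sub_le ha (2 * (M + N + 1))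
  obtain ⟨C₂, hC₂⟩ := exists_abs_partialExpansion_sub_le a (saddleCoeff a) (by linarith)
    (show M ≤ M + N + 1 by omega) (show N ≤ M + N + 1 by omega)
  refine IsBigO.of_bound (|C₁| + C₂) ?_
  filter_upwards [eventually_ge_atTop 1] with x hx
  have hx0 : 0 < x := by linarith
  have h1 := hC₁ x hx
  have h2 := hC₂ x hx
  rw [re_saddle_sum_eq_partialExpansion ha hx0] at h1
  set B := x ^ (-1 / 2 : ℝ) * (1 / x ^ (2 * M) + 1 / x ^ (2 * N + 1)) with hB
  have hB0 : 0 ≤ B := by positivity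
  have h3 : 1 / x ^ (2 * (M + N + 1)) ≤ B := by
    have h4 : 1 / x ^ 1 ≤ x ^ (-1 / 2 : ℝ) := by
      rw [pow_one, one_div, ← Real.rpow_neg_one]
      exact Real.rpow_le_rpow_of_exponent_le hx (by norm_num)
    have h5 : 1 / x ^ (2 * (M + N + 1)) ≤ 1 / x ^ 1 * (1 / x ^ (2 * M)) := by
      rw [one_div_mul_one_div, ← pow_add]
      exact one_div_le_one_div_of_le (by positivity) (pow_le_pow_right₀ hx (by omega))
    refine h5.trans ?_
    rw [hB]
    refine mul_le_mul h4 ?_ (by positivity) (by positivity)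
    have : 0 ≤ 1 / x ^ (2 * N + 1) := by positivity
    linarith
  rw [Real.norm_eq_abs, Real.norm_of_nonneg hB0]
  have h6 : C₁ / x ^ (2 * (M + N + 1)) ≤ |C₁| * B := by
    rw [div_eq_mul_one_div]
    exact mul_le_mul (le_abs_self _) h3 (by positivity) (abs_nonneg _)
  have h7 := abs_add_le (batemanK (a * x) x - partialExpansion a (saddleCoeff a) (M + N + 1)
    (M + N + 1) x) (partialExpansion a (saddleCoeff a) (M + N + 1) (M + N + 1) x -
    partialExpansion a (saddleCoeff a) M N x)
  rw [sub_add_sub_cancel] at h7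
  linarith

theorem sqrt_pow_eq_rpow {t : ℝ} (ht : 0 ≤ t) (n : ℕ) :
    Real.sqrt t ^ n = t ^ ((n : ℝ) / 2) := by
  rw [Real.sqrt_eq_rpow, ← Real.rpow_natCast, ← Real.rpow_mul ht]
  congr 1
  ring

theorem theorem1 (a : ℝ) (ha : 1 < a) :
    ∃ A : ℕ → ℝ,
      (IsSaddleCoeffs a A ∧ ∀ B : ℕ → ℝ, IsSaddleCoeffs a B → B = A) ∧
      A 0 = 1 ∧
      A 1 = (8 - 12 * a + 9 * a ^ 2) / (24 * a * (a - 1) ^ (3 / 2 : ℝ)) ∧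
      A 2 = (64 - 192 * a + 288 * a ^ 2 + 360 * a ^ 3 - 135 * a ^ 4) /
        (3456 * a ^ 2 * (a - 1) ^ 3) ∧
      A 3 = (-71168 + 320256 * a - 554688 * a ^ 2 + 518400 * a ^ 3 + 340200 * a ^ 4
          - 170100 * a ^ 5 + 42525 * a ^ 6) /
        (6220800 * a ^ 3 * (a - 1) ^ (9 / 2 : ℝ)) ∧
      A 4 = (-2338816 + 14032896 * a - 36790272 * a ^ 2 + 55710720 * a ^ 3
          - 32876928 * a ^ 4 + 231880320 * a ^ 5 - 68584320 * a ^ 6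
          + 30618000 * a ^ 7 - 5740875 * a ^ 8) /
        (4180377600 * a ^ 4 * (a - 1) ^ 6) ∧
      ∀ M N : ℕ,
        (fun x : ℝ => batemanK (a * x) x - partialExpansion a A M N x) =O[atTop]
          (fun x : ℝ => x ^ (-1 / 2 : ℝ) * (1 / x ^ (2 * M) + 1 / x ^ (2 * N + 1))) := by
  have h0 : 0 ≤ a - 1 := by linarith
  have h3 : (a - 1) ^ (3 / 2 : ℝ) = Real.sqrt (a - 1) ^ 3 := by
    rw [sqrt_pow_eq_rpow h0, Nat.cast_ofNat]
  have h9 : (a - 1) ^ (9 / 2 : ℝ) = Real.sqrt (a - 1) ^ 9 := by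
    rw [sqrt_pow_eq_rpow h0, Nat.cast_ofNat]
  have h6 : (a - 1) ^ 3 = Real.sqrt (a - 1) ^ 6 := by
    rw [show 6 = 2 * 3 from rfl, pow_mul, Real.sq_sqrt h0]
  have h12 : (a - 1) ^ 6 = Real.sqrt (a - 1) ^ 12 := by
    rw [show 12 = 2 * 6 from rfl, pow_mul, Real.sq_sqrt h0]
  obtain ⟨hA1, hA2, hA3, hA4⟩ := saddleCoeff_values ha
  rw [h3, h9, h6, h12]
  exact ⟨saddleCoeff a, ⟨isSaddleCoeffs_saddleCoeff ha, fun B hB => hB.eq_saddleCoeff ha⟩,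
    saddleCoeff_zero ha, hA1, hA2, hA3, hA4, batemanK_sub_partialExpansion_isBigO ha⟩
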